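/- Let $B_6 = O(6)\cap GL(6,\mathbb{Z})$ be the hyperoctahedral group of all integral orthogonal $6\times 6$ matrices. Let $\mathcal{I}$ be the icosahedral group (the rotation group of a regular icosahedron, of order $60$). Label the vertices of the icosahedron by $1,\dots,12$ so that the vertices $i$ and $i+6$ are opposite ($1\le i\le 6$); then $\mathcal{I}$ is the group of vertex permutations generated by $$g_2=(1,6)(2,5)(3,9)(4,10)(7,12)(8,11),\qquad g_3=(1,5,6)(2,9,4)(7,11,12)(3,10,8).$$ Sending the vertices $i$ and $i+6$ to $e_i$ and $-e_i$ ($1\le i\le 6$) turns this permutation action into a faithful representation of $\mathcal{I}$ by signed permutation matrices; let $\hat{\mathcal{I}}\le B_6$ be its image, and for a subgroup $\mathcal{G}\le\mathcal{I}$ let $\mathcal{K}_{\mathcal{G}}\le\hat{\mathcal{I}}$ be the image of $\mathcal{G}$. For a subgroup $K\le B_6$ write $\mathcal{C}_{B_6}(K)=\{gKg^{-1}:g\in B_6\}$. A subgroup $\mathcal{H}\le B_6$ is called a crystallographic representation of $\mathcal{I}$ if $\mathcal{H}\cong\mathcal{I}$ and its action on $\mathbb{R}^6$ splits over $\mathbb{R}$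 as $T_1\oplus T_2$, the sum of the two inequivalent three-dimensional irreducible representations of $\mathcal{I}$. The $\mathcal{G}$-graph has vertex set $\mathcal{C}_{B_6}(\hat{\mathcal{I}})$, and two distinct vertices $\mathcal{H}_1,\mathcal{H}_2$ are adjacent if and only if $\mathcal{H}_1\cap\mathcal{H}_2\in\mathcal{C}_{B_6}(\mathcal{K}_{\mathcal{G}})$. Then the following hold. 1. The crystallographic representations of $\mathcal{I}$ in $B_6$ are exactly the elements of $\mathcal{C}_{B_6}(\hat{\mathcal{I}})$, and there are exactly $192$ of them. 2. For every subgroup $\mathcal{G}$ of $\mathcal{I}$, the $\mathcal{G}$-graph is regular. 3. If $\mathcal{G}\le\mathcal{I}$ is isomorphic to $\mathcal{T}$, $\mathcal{D}_{10}$, $\mathcal{D}_6$, $C_5$, $\mathcal{D}_4$, $C_3$, $C_2$ or $\{e\}$, then the $\mathcal{G}$-graph is regular of degree $d_{\mathcal{G}}=5,6,10,0,30,20,60,60$, respectively, where $\mathcal{T}\cong A_4$ is the tetrahedral group, $\mathcal{D}_{2n}$ is the dihedral group of order $2n$ and $C_n$ is the cyclic group of order $n$. Moreover, for such $\mathcal{G}$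 and for every crystallographic representation $\mathcal{H}$ of $\mathcal{I}$ in $B_6$ there are exactly $d_{\mathcal{G}}$ elements $\mathcal{K}\in\mathcal{C}_{B_6}(\hat{\mathcal{I}})$ with $\mathcal{H}\cap\mathcal{K}\in\mathcal{C}_{B_6}(\mathcal{K}_{\mathcal{G}})$. -/

import Mathlib

namespace IcosahedralGraph

/-- The hyperoctahedral group `B₆ = O(6) ∩ GL(6, ℤ)`: all integral orthogonal `6 × 6` matrices. -/
abbrev B6 : Type := Matrix.orthogonalGroup (Fin 6) ℤ

/-- `B₆` is finite, since the entries of an integral orthogonal matrix lie in `{-1, 0, 1}`. -/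
instance finite_B6 : Finite B6 := by
  have bound : ∀ (A : B6) (i j : Fin 6), A.1 i j ∈ Set.Icc (-1 : ℤ) 1 := by
    intro A i j
    have h : A.1 * star A.1 = 1 := (Matrix.mem_orthogonalGroup_iff (Fin 6) ℤ).1 A.2
    have h1 : ∑ k, A.1 i k * A.1 i k = 1 := by
      have h2 := congrFun (congrFun h i) i
      simpa [Matrix.mul_apply, Matrix.star_apply] using h2
    have h2 : A.1 i j * A.1 i j ≤ 1 := by
      rw [← h1]
      exact Finset.single_le_sum (f := fun k => A.1 i k * A.1 i k)
        (fun k _ => mul_self_nonneg _) (Finset.mem_univ j)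
    exact ⟨by nlinarith, by nlinarith⟩
  refine Finite.of_injective
    (fun (A : B6) (i j : Fin 6) => (⟨A.1 i j, bound A i j⟩ : Set.Icc (-1 : ℤ) 1)) ?_
  intro A B h
  apply Subtype.ext
  ext i j
  exact congrArg Subtype.val (congrFun (congrFun h i) j)

/-! ### The icosahedral group

The twelve vertices of the regular icosahedron are labelled by `Fin 12` (the labels are shifted by
one, so that they start at `0`); the vertex opposite to `k` is `k + 6` (modulo `12`). -/

/-- The vertex permutation of the two-fold rotation `g₂`,
`(1,6)(2,5)(3,9)(4,10)(7,12)(8,11)` with labels starting at `1`. -/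
def g2 : Equiv.Perm (Fin 12) :=
  c[0, 5] * c[1, 4] * c[2, 8] * c[3, 9] * c[6, 11] * c[7, 10]

/-- The vertex permutation of the three-fold rotation `g₃`,
`(1,5,6)(2,9,4)(7,11,12)(3,10,8)` with labels starting at `1`. -/
def g3 : Equiv.Perm (Fin 12) :=
  c[0, 4, 5] * c[1, 8, 3] * c[6, 10, 11] * c[2, 9, 7]

/-- The icosahedral group `𝓘` (order `60`, isomorphic to `A₅`), the group of rotations of a regular
icosahedron, given by its faithful action on the twelve vertices. -/
def icosahedralGroup : Subgroup (Equiv.Perm (Fin 12)) := Subgroup.closure {g2, g3}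

/-- Every rotation of the icosahedron maps opposite vertices to opposite vertices. -/
theorem apply_add_six (p : icosahedralGroup) (k : Fin 12) : p.1 (k + 6) = p.1 k + 6 := by
  obtain ⟨p, hp⟩ := p
  revert k
  induction hp using Subgroup.closure_induction with
  | mem x hx =>
    rcases hx with rfl | rfl
    · decide
    · decide
  | one => intro k; rfl
  | mul x y _ _ hx hy =>
    intro k
    simp only [Equiv.Perm.mul_apply] at hx hy ⊢
    rw [hy, hx]
  | inv x _ hx =>
    intro k
    simp only at hx ⊢
    rw [Equiv.Perm.inv_eq_iff_eq, hx]
    exact congrArg (· + 6) (x.apply_symm_apply k).symm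

/-- The vertex labels `0, …, 5`, which stand for the basis vectors `e₁, …, e₆` of `ℝ⁶`; the opposite
vertices `6, …, 11` stand for `-e₁, …, -e₆`. -/
def vtx (i : Fin 6) : Fin 12 := Fin.castLE (by norm_num) i

/-- The signed permutation matrix of a permutation of the vertices: the `j`-th basis vector goes
to `e_i` if vertex `j` goes to vertex `i`, and to `-e_i` if `j` goes to the vertex opposite
to `i`. -/
def signedMatrix (p : Equiv.Perm (Fin 12)) : Matrix (Fin 6) (Fin 6) ℤ :=
  Matrix.of fun i j => if p (vtx j) = vtx i then 1 else if p (vtx j) = vtx i + 6 then -1 else 0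

theorem signedMatrix_one : signedMatrix 1 = 1 := by decide

/-- The signed coordinate of the vertex `k` along the `i`-th axis. -/
def coord (i : Fin 6) (k : Fin 12) : ℤ := if k = vtx i then 1 else if k = vtx i + 6 then -1 else 0

theorem coord_eq (p : Equiv.Perm (Fin 12)) (hp : ∀ k, p (k + 6) = p k + 6) (i : Fin 6)
    (k : Fin 12) : coord i (p k) = ∑ l, signedMatrix p i l * coord l k := by
  have hneg : ∀ (i : Fin 6) (m : Fin 12), coord i (m + 6) = - coord i m := by decide
  have key : ∀ j : Fin 6, coord i (p (vtx j)) = ∑ l, signedMatrix p i l * coord l (vtx j) := by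
    intro j
    have h : ∀ l j : Fin 6, coord l (vtx j) = if l = j then 1 else 0 := by decide
    simp only [h]
    simp [signedMatrix, coord]
  have hk : ∀ k : Fin 12, ∃ j : Fin 6, k = vtx j ∨ k = vtx j + 6 := by decide
  obtain ⟨j, rfl | rfl⟩ := hk k
  · exact key j
  · rw [hp, hneg, key, ← Finset.sum_neg_distrib]
    refine Finset.sum_congr rfl fun l _ => ?_
    rw [hneg, mul_neg]

theorem signedMatrix_mul (p q : Equiv.Perm (Fin 12)) (hp : ∀ k, p (k + 6) = p k + 6) :
    signedMatrix (p * q) = signedMatrix p * signedMatrix q := by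
  ext i j
  rw [Matrix.mul_apply]
  exact coord_eq p hp i (q (vtx j))

theorem transpose_signedMatrix (p : Equiv.Perm (Fin 12)) (hp : ∀ k, p (k + 6) = p k + 6) :
    Matrix.transpose (signedMatrix p) = signedMatrix p⁻¹ := by
  have h6 : ∀ k : Fin 12, k + 6 + 6 = k := by decide
  ext i j
  have e1 : p (vtx i) = vtx j ↔ p⁻¹ (vtx j) = vtx i := by
    rw [Equiv.Perm.inv_eq_iff_eq, eq_comm]
  have e2 : p (vtx i) = vtx j + 6 ↔ p⁻¹ (vtx j) = vtx i + 6 := by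
    rw [Equiv.Perm.inv_eq_iff_eq, hp]
    constructor
    · intro h; rw [h, h6]
    · intro h; rw [h, h6]
  simp only [signedMatrix, Matrix.transpose_apply, Matrix.of_apply, e1, e2]

/-- The representation `Î : 𝓘 → B₆` by signed permutation matrices. -/
def icosahedralRep : icosahedralGroup →* B6 where
  toFun p := ⟨signedMatrix p.1, by
    rw [Matrix.mem_orthogonalGroup_iff]
    change signedMatrix p.1 * star (signedMatrix p.1) = 1
    have hs : star (signedMatrix p.1) = signedMatrix p.1⁻¹ := by
      rw [← transpose_signedMatrix p.1 (apply_add_six p)]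
      ext i j
      simp [Matrix.star_apply]
    rw [hs, ← signedMatrix_mul _ _ (apply_add_six p), mul_inv_cancel, signedMatrix_one]⟩
  map_one' := Subtype.ext signedMatrix_one
  map_mul' p q := Subtype.ext (signedMatrix_mul p.1 q.1 (apply_add_six p))

/-- The subgroup `Î` of `B₆`, the image of the representation above. -/
def hatI : Subgroup B6 := icosahedralRep.range

/-- The subgroup `K_G = Î(G)` of `B₆` that represents the subgroup `G` of `𝓘`. -/
def subgroupRep (G : Subgroup icosahedralGroup) : Subgroup B6 := G.map icosahedralRep

/-! ### Crystallographic representations -/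

/-- The conjugacy class `{g H g⁻¹ : g ∈ Γ}` of a subgroup `H` of a group `Γ`. -/
def conjClass {Γ : Type*} [Group Γ] (H : Subgroup Γ) : Set (Subgroup Γ) :=
  {K | ∃ g : Γ, K = H.map (MulAut.conj g).toMonoidHom}

/-- The natural representation of a subgroup `H` of `B₆` on `ℝ⁶`. -/
noncomputable def natRep (H : Subgroup B6) : Representation ℝ H (Fin 6 → ℝ) where
  toFun A := Matrix.toLin' ((A.1.1).map (Int.cast : ℤ → ℝ))
  map_one' := by
    simp
    rfl
  map_mul' A B := by
    rw [show ((A * B : H).1.1) = A.1.1 * B.1.1 from rfl]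
    rw [Matrix.map_mul_intCast, Matrix.toLin'_mul]
    rfl

/-- `H ≤ B₆` is an (orthogonal) crystallographic representation of `𝓘`: it is isomorphic to `𝓘`, and
its action on `ℝ⁶` splits over `ℝ` as `T₁ ⊕ T₂`, that is, into the two inequivalent
three-dimensional irreducible representations of `𝓘`. -/
def IsCrystallographic (H : Subgroup B6) : Prop :=
  Nonempty (icosahedralGroup ≃* H) ∧
    ∃ V W : Subrepresentation (natRep H),
      IsCompl V.toSubmodule W.toSubmodule ∧
      Module.finrank ℝ V.toSubmodule = 3 ∧ Module.finrank ℝ W.toSubmodule = 3 ∧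
      V.toRepresentation.IsIrreducible ∧ W.toRepresentation.IsIrreducible ∧
      IsEmpty (Representation.Equiv V.toRepresentation W.toRepresentation)

/-- The class of `Î` in `B₆`. -/
def crystClass : Set (Subgroup B6) := conjClass hatI

/-- The `G`-graph: its vertices are the elements of the class of `Î`, and two distinct vertices are
adjacent if their intersection belongs to the class of `K_G` in `B₆`. -/
def subgroupGraph (G : Subgroup icosahedralGroup) : SimpleGraph crystClass where
  Adj H K := H ≠ K ∧ ∃ P ∈ conjClass (subgroupRep G), P = H.1 ⊓ K.1
  symm := ⟨fun H K h => ⟨h.1.symm, by rw [inf_comm]; exact h.2⟩⟩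
  loopless := ⟨fun _ h => h.1 rfl⟩

noncomputable instance (G : Subgroup icosahedralGroup) : (subgroupGraph G).LocallyFinite :=
  fun _ => Fintype.ofFinite _

end IcosahedralGraph

namespace IcosahedralGraph
open Equiv

/-! ### Permutations of the vertices as numbers -/

/-! An integral orthogonal matrix permutes the twelve vectors ±e_i and respects negation, so `B6` is
the group of signed permutations of the vertices (`signedRep_surjective`), and all questions about
conjugates of `hatI` become questions about permutations.

Size of the class. Rotations carry the vertex 0 and the axis of 1 to any vertex and any other axis,
and the powers of `outerPerm`, which normalizes the icosahedral group, fix 0, keep the axis of 1 and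
are transitive on the other four axes. So every signed permutation can be moved into `frameStab`, a
group of order 192, by a normalizing factor on the right (`exists_mul_mem_frameStab`). Only the
identity of `frameStab` normalizes the icosahedral group, so `frameStab` parametrizes the class
without repetition (`range_frameClass`, `frameClass_injective`).

Degrees. Conjugation in `B6` is transitive on the class and preserves adjacency, which gives
regularity for every G. For the eight types the class of an intersection is determined by its order,
because icosahedral subgroups of equal order in the relevant range are conjugate
(`exists_conjBy_eq_of_card_eq`, by Sylow theory). It remains to tabulate the orders of the 192
intersections with `hatI` (`map_interCount`) and to count.

Crystallographic representations. `adjMatrix` commutes with `hatI`, squares to 5 and has trace 0, so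
ℝ⁶ is the sum of two three-dimensional eigenspaces for ±√5. The commutant is spanned by 1 and
`adjMap` (`exists_eq_smul_add_smul`), which makes the eigenspaces irreducible and inequivalent.
Conversely, of the splitting only the absence of an invariant line is used: it forces the action on
the twelve vectors to be transitive with stabilizers of order 5, hence equivalent to the action on
the vertices (`exists_equivariant`), and the equivalence is a conjugating element of `B6`.

For the finite checks a permutation is encoded as a number with twelve hexadecimal digits, so that
they become integer arithmetic. -/

/-- The `k`-th hexadecimal digit of `c`. -/
def digit (c k : ℕ) : ℕ := Nat.mod (Nat.shiftRight c (Nat.mul 4 k)) 16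

theorem digit_eq (c k : ℕ) : digit c k = c / 2 ^ (4 * k) % 16 :=
  congrArg (· % 16) (Nat.shiftRight_eq_div_pow c (4 * k))

/-- The number with hexadecimal digits `f 0, …, f 11`. -/
def ofDigits (f : ℕ → ℕ) : ℕ :=
  f 0 + 16 * (f 1 + 16 * (f 2 + 16 * (f 3 + 16 * (f 4 + 16 * (f 5 + 16 * (f 6 + 16 * (f 7 +
    16 * (f 8 + 16 * (f 9 + 16 * (f 10 + 16 * f 11))))))))))

/-- The number whose hexadecimal digits are the values of `f`. -/
def code (f : Fin 12 → Fin 12) : ℕ := ofDigits fun k => if h : k < 12 then f ⟨k, h⟩ else 0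

/-- The code of a composition of maps in terms of their codes. -/
def codeMul (a b : ℕ) : ℕ := ofDigits fun k => digit a (digit b k)

/-- Values below 16 produce no carries. -/
theorem digit_ofDigits (f : ℕ → ℕ) (hf : ∀ k, f k < 16) (k : ℕ) (hk : k < 12) :
    digit (ofDigits f) k = f k := by
  have h := fun k => hf k
  have h0 := hf 0
  have h1 := hf 1
  have h2 := hf 2
  have h3 := hf 3
  have h4 := hf 4
  have h5 := hf 5
  have h6 := hf 6
  have h7 := hf 7
  have h8 := hf 8
  have h9 := hf 9
  have h10 := hf 10
  have h11 := hf 11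
  rw [digit_eq]
  unfold ofDigits
  interval_cases k <;> norm_num <;> omega

theorem digit_code (f : Fin 12 → Fin 12) (k : Fin 12) : digit (code f) k = f k := by
  unfold code
  rw [digit_ofDigits _ _ _ k.2]
  · simp
  · intro k
    split <;> omega

theorem code_injective : Function.Injective code := by
  intro f g h
  ext k
  rw [← digit_code, h, digit_code]

theorem code_inj {p q : Perm (Fin 12)} : code p = code q ↔ p = q :=
  ⟨fun h => Equiv.coe_fn_injective (code_injective h), fun h => h ▸ rfl⟩

theorem ofDigits_congr {f g : ℕ → ℕ} (h : ∀ k < 12, f k = g k) : ofDigits f = ofDigits g := by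
  unfold ofDigits
  simp [h]

theorem code_mul (p q : Perm (Fin 12)) : code (p * q : Perm (Fin 12)) = codeMul (code p) (code q) := by
  refine ofDigits_congr fun k hk => ?_
  have h1 := digit_code q ⟨k, hk⟩
  simp only [] at h1
  rw [h1, digit_code]
  simp [hk]

/-- A code with pairwise distinct digits smaller than `12` is the code of a permutation. -/
theorem exists_perm_code (c : ℕ) (h1 : c = ofDigits (digit c)) (h2 : ∀ k < 12, digit c k < 12)
    (h3 : ∀ k < 12, ∀ l < k, digit c k ≠ digit c l) : ∃ p : Perm (Fin 12), code p = c := by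
  let f : Fin 12 → Fin 12 := fun k => ⟨digit c k, h2 k k.2⟩
  have hf : Function.Injective f := by
    intro k l h
    have h' : digit c k = digit c l := congrArg Fin.val h
    by_contra hkl
    rcases lt_or_gt_of_ne hkl with hlt | hlt
    · exact h3 l l.2 k hlt h'.symm
    · exact h3 k k.2 l hlt h'
  refine ⟨Equiv.ofBijective f (Finite.injective_iff_bijective.1 hf), ?_⟩
  rw [h1]
  refine ofDigits_congr fun k hk => ?_
  simp [hk, f]

/-- The code of the inverse of a permutation in terms of its code. -/
def codeInv (a : ℕ) : ℕ :=
  0 * 16 ^ digit a 0 + 1 * 16 ^ digit a 1 + 2 * 16 ^ digit a 2 + 3 * 16 ^ digit a 3 +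
    4 * 16 ^ digit a 4 + 5 * 16 ^ digit a 5 + 6 * 16 ^ digit a 6 + 7 * 16 ^ digit a 7 +
    8 * 16 ^ digit a 8 + 9 * 16 ^ digit a 9 + 10 * 16 ^ digit a 10 + 11 * 16 ^ digit a 11

theorem sum_fin_twelve (g : Fin 12 → ℕ) : ∑ k, g k = g 0 + g 1 + g 2 + g 3 + g 4 + g 5 + g 6 +
    g 7 + g 8 + g 9 + g 10 + g 11 := by
  simp only [Fin.sum_univ_castSucc, Finset.univ_eq_empty, Finset.sum_empty, zero_add]
  rfl

theorem code_eq_sum (f : Fin 12 → Fin 12) : code f = ∑ k, (f k : ℕ) * 16 ^ (k : ℕ) := by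
  rw [sum_fin_twelve]
  change (f 0 : ℕ) + 16 * (f 1 + 16 * (f 2 + 16 * (f 3 + 16 * (f 4 + 16 * (f 5 + 16 * (f 6 +
    16 * (f 7 + 16 * (f 8 + 16 * (f 9 + 16 * (f 10 + 16 * f 11)))))))))) =
    (f 0 : ℕ) * 16 ^ 0 + f 1 * 16 ^ 1 + f 2 * 16 ^ 2 + f 3 * 16 ^ 3 + f 4 * 16 ^ 4 + f 5 * 16 ^ 5 +
    f 6 * 16 ^ 6 + f 7 * 16 ^ 7 + f 8 * 16 ^ 8 + f 9 * 16 ^ 9 + f 10 * 16 ^ 10 + f 11 * 16 ^ 11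
  generalize (f 0 : ℕ) = x0, (f 1 : ℕ) = x1, (f 2 : ℕ) = x2, (f 3 : ℕ) = x3, (f 4 : ℕ) = x4,
    (f 5 : ℕ) = x5, (f 6 : ℕ) = x6, (f 7 : ℕ) = x7, (f 8 : ℕ) = x8, (f 9 : ℕ) = x9,
    (f 10 : ℕ) = x10, (f 11 : ℕ) = x11
  ring

/-- Reindexing the digit sum of the inverse along `p` puts the digit `k` at position `p k`, so no
digit of the inverse has to be searched for. -/
theorem code_inv (p : Perm (Fin 12)) : code (p⁻¹ : Perm (Fin 12)) = codeInv (code p) := by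
  have h : code (p⁻¹ : Perm (Fin 12)) = ∑ k : Fin 12, (k : ℕ) * 16 ^ (p k : ℕ) := by
    rw [code_eq_sum, ← Equiv.sum_comp p]
    simp
  rw [h]
  simp only [← digit_code]
  rw [sum_fin_twelve]
  rfl

/-! ### Enumeration of the icosahedral group -/

/-- The product of the generators described by a word: `true` stands for `g₃`, `false` for `g₂`. -/
def wordPerm (w : List Bool) : Perm (Fin 12) := (w.map fun b => cond b g3 g2).prod

/-- The code of `wordPerm w`. -/
def wordCode (w : List Bool) : ℕ :=
  w.foldr (fun b c => codeMul (cond b 118142370388356 113467315034181) c) 205163983024656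

theorem code_one : code (1 : Perm (Fin 12)) = 205163983024656 := by decide +kernel

theorem code_g2 : code g2 = 113467315034181 := by decide +kernel

theorem code_g3 : code g3 = 118142370388356 := by decide +kernel

theorem code_wordPerm (w : List Bool) : code (wordPerm w) = wordCode w := by
  induction w with
  | nil => exact code_one
  | cons b w ih =>
    have h : wordPerm (b :: w) = cond b g3 g2 * wordPerm w := by simp [wordPerm]
    rw [h, code_mul, ih]
    cases b
    · exact congrArg (codeMul · (wordCode w)) code_g2
    · exact congrArg (codeMul · (wordCode w)) code_g3

theorem wordPerm_mem (w : List Bool) : wordPerm w ∈ icosahedralGroup := by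
  refine Subgroup.list_prod_mem _ fun x hx => Subgroup.subset_closure ?_
  obtain ⟨b, -, rfl⟩ := List.mem_map.1 hx
  cases b <;> simp

/-- Words for rotations that move the vertex `0` to the vertices `0, …, 11`. -/
def vertexWords : List (List Bool) := [
  [],
  [false, true],
  [false, true, false, true],
  [true, true, false, true],
  [true],
  [false],
  [true, true, false, true, false, true, true, false, true],
  [true, false, true, true, false, true],
  [true, false, true],
  [false, true, true, false, true],
  [false, true, false, true, true, false, true],
  [true, false, true, false, true, true, false, true]]

/-- The codes of the elements of the icosahedral group. -/
def icoCodes : List ℕ := [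
    205163983024656, 178231316083536, 38833593366336, 60770139351936, 135807773256336,
    200839235912481, 109035110630481, 57528530155521, 79187245427601, 153451785172641,
    201668449862706, 127778365804626, 70727250655506, 9987013442466, 171115929749346,
    188437819099251, 202819786379331, 141045537349971, 1462594157091, 28746374744931,
    118142370388356, 203991255556356, 159466669957716, 20137398285876, 42009519758196,
    113467315034181, 132230954526981, 150652338792981, 169395845625381, 182663268828981,
    28184925128886, 167924903072886, 145666234520886, 76104684245286, 89211851475366,
    46606057736631, 186599707201671, 158929379534151, 5809235534391, 90383320652391,
    117335050703256, 177688740836616, 23131124884296, 91534657169016, 59873229281976,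
    130533771203241, 108488508851481, 40795269461001, 92363871119241, 78616484456121,
    149228707992426, 126905614927146, 58439281377306, 88039124007066, 9420279003066,
    55419130610091, 36997746344091, 18254239511691, 4986816308091, 74182770102891]

/-- The block `[true, false]` is the five-fold rotation `g3 * g2` about the vertex 0. Each row of
the list is thus a left coset of the stabilizer of 0, and the twelve words are coset
representatives. -/
theorem icoCodes_eq : icoCodes = vertexWords.flatMap fun w =>
    (List.range 5).map fun i => wordCode (w ++ (List.replicate i [true, false]).flatten) := by
  decide +kernel

theorem icoCodes_nodup : icoCodes.Nodup := by decide +kernel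

theorem exists_of_mem_icoCodes {c : ℕ} (h : c ∈ icoCodes) :
    ∃ p ∈ icosahedralGroup, code p = c := by
  rw [icoCodes_eq] at h
  simp only [List.mem_flatMap, List.mem_map] at h
  obtain ⟨w, -, i, -, h⟩ := h
  exact ⟨_, wordPerm_mem _, (code_wordPerm _).trans h⟩

/-- Listed codes come from words in the generators. Conversely, the list contains the identity and
is stable under left multiplication by the generators and their inverses. -/
theorem code_mem_icoCodes {p : Perm (Fin 12)} : code p ∈ icoCodes ↔ p ∈ icosahedralGroup := by
  constructor
  · intro h
    obtain ⟨q, hq, h⟩ := exists_of_mem_icoCodes h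
    exact code_inj.1 h ▸ hq
  · intro h
    induction h using Subgroup.closure_induction_left with
    | one => rw [code_one]; decide +kernel
    | mul_left x hx y _ ih =>
      rw [code_mul]
      generalize code y = c at ih
      rcases hx with rfl | rfl
      · rw [code_g2]; revert c; decide +kernel
      · rw [code_g3]; revert c; decide +kernel
    | inv_mul_cancel x hx y _ ih =>
      rw [code_mul, code_inv]
      generalize code y = c at ih
      rcases hx with rfl | rfl
      · rw [code_g2]; revert c; decide +kernel
      · rw [code_g3]; revert c; decide +kernel

/-- Sets of permutations can be counted by means of codes. -/
theorem ncard_of_codes (L : List ℕ) (hL : L.Nodup) (hex : ∀ c ∈ L, ∃ p : Perm (Fin 12), code p = c)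
    (s : Set (Perm (Fin 12))) (Q : ℕ → Bool) (h : ∀ p, p ∈ s ↔ code p ∈ L ∧ Q (code p) = true) :
    s.ncard = L.countP Q := by
  have hinj : Function.Injective fun p : Perm (Fin 12) => code p := fun p q => code_inj.1
  have himg : (fun p : Perm (Fin 12) => code p) '' s = ((L.filter Q).toFinset : Set ℕ) := by
    ext c
    simp only [Set.mem_image, List.coe_toFinset, Set.mem_ofPred_eq, List.mem_filter]
    constructor
    · rintro ⟨p, hp, rfl⟩
      exact (h p).1 hp
    · rintro ⟨hc, hQ⟩
      obtain ⟨p, rfl⟩ := hex c hc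
      exact ⟨p, (h p).2 ⟨hc, hQ⟩, rfl⟩
  rw [← Set.ncard_image_of_injective s hinj, himg, Set.ncard_coe_finset,
    List.toFinset_card_of_nodup (hL.filter _), List.countP_eq_length_filter]

/-- The number of rotations with a property that can be read off from their codes. -/
theorem ncard_ico (s : Set (Perm (Fin 12))) (Q : ℕ → Bool)
    (h : ∀ p, p ∈ s ↔ p ∈ icosahedralGroup ∧ Q (code p) = true) :
    s.ncard = icoCodes.countP Q :=
  ncard_of_codes icoCodes icoCodes_nodup
    (fun _ hc => (exists_of_mem_icoCodes hc).imp fun _ hp => hp.2) s Q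
    fun p => by rw [h, code_mem_icoCodes]

theorem card_icosahedralGroup : Nat.card icosahedralGroup = 60 :=
  (ncard_ico icosahedralGroup (fun _ => true) (by simp)).trans (by rfl)

/-! ### Signed permutations -/

/-- The permutations of the vertices that map opposite vertices to opposite vertices. -/
def signedPerms : Subgroup (Perm (Fin 12)) where
  carrier := {p | ∀ k, p (k + 6) = p k + 6}
  one_mem' _ := rfl
  mul_mem' {p q} hp hq k := by
    simp only [Set.mem_ofPred_eq, Perm.mul_apply] at hp hq ⊢
    rw [hq, hp]
  inv_mem' {p} hp k := by
    simp only [Set.mem_ofPred_eq] at hp ⊢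
    rw [Perm.inv_eq_iff_eq, hp]
    exact congrArg (· + 6) (p.apply_symm_apply k).symm

theorem mem_signedPerms {p : Perm (Fin 12)} : p ∈ signedPerms ↔ ∀ k, p (k + 6) = p k + 6 := Iff.rfl

theorem icosahedralGroup_le : icosahedralGroup ≤ signedPerms :=
  fun p hp => apply_add_six ⟨p, hp⟩

theorem add_six_add_six : ∀ k : Fin 12, k + 6 + 6 = k := by decide

theorem add_six_ne : ∀ k : Fin 12, k + 6 ≠ k := by decide

/-- Two vertices on the same axis. -/
def SameAxis (k l : Fin 12) : Prop := k = l ∨ k = l + 6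

instance : DecidableRel SameAxis := fun k l => inferInstanceAs (Decidable (k = l ∨ k = l + 6))

theorem sameAxis_apply {p : Perm (Fin 12)} (hp : p ∈ signedPerms) {k l : Fin 12} :
    SameAxis (p k) (p l) ↔ SameAxis k l := by
  unfold SameAxis
  rw [← hp l, p.apply_eq_iff_eq, p.apply_eq_iff_eq]

theorem SameAxis.trans : ∀ {k l m : Fin 12}, SameAxis k l → SameAxis l m → SameAxis k m := by
  decide

theorem SameAxis.symm : ∀ {k l : Fin 12}, SameAxis k l → SameAxis l k := by
  decide

/-- The signed permutations that fix the vertex `0` and preserve the axes of `1` and `2`. -/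
def frameStab : Subgroup (Perm (Fin 12)) where
  carrier := {p | p ∈ signedPerms ∧ p 0 = 0 ∧ SameAxis (p 1) 1 ∧ SameAxis (p 2) 2}
  one_mem' := ⟨one_mem _, rfl, Or.inl rfl, Or.inl rfl⟩
  mul_mem' {p q} hp hq := by
    obtain ⟨h, h0, h1, h2⟩ := hp
    obtain ⟨h', h0', h1', h2'⟩ := hq
    refine ⟨mul_mem h h', ?_, ?_, ?_⟩
    · rw [Perm.mul_apply, h0', h0]
    · exact ((sameAxis_apply h).2 h1').trans h1
    · exact ((sameAxis_apply h).2 h2').trans h2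
  inv_mem' {p} hp := by
    obtain ⟨h, h0, h1, h2⟩ := hp
    refine ⟨inv_mem h, ?_, ?_, ?_⟩
    · rw [Perm.inv_eq_iff_eq, h0]
    · rw [← sameAxis_apply h]
      simpa using h1.symm
    · rw [← sameAxis_apply h]
      simpa using h2.symm

/-- The code of the signed permutation that fixes `0` and maps `1, …, 5` to `a, b, c, d, e`. -/
def frameCode (a b c d e : ℕ) : ℕ :=
  16 * (a + 16 * (b + 16 * (c + 16 * (d + 16 * (e + 16 * (6 + 16 * ((a + 6) % 12 +
    16 * ((b + 6) % 12 + 16 * ((c + 6) % 12 + 16 * ((d + 6) % 12 + 16 * ((e + 6) % 12)))))))))))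

/-- The codes of the elements of `frameStab`. -/
def frameCodes : List ℕ :=
  [1, 7].flatMap fun a => [2, 8].flatMap fun b => [3, 4, 5, 9, 10, 11].flatMap fun c =>
    ([3, 4, 5, 9, 10, 11].filter fun d => d % 6 != c % 6).flatMap fun d =>
      ([3, 4, 5, 9, 10, 11].filter fun e => e % 6 != c % 6 && e % 6 != d % 6).map fun e =>
        frameCode a b c d e

theorem code_apply (f : Fin 12 → Fin 12) : code f = f 0 + 16 * (f 1 + 16 * (f 2 + 16 * (f 3 +
    16 * (f 4 + 16 * (f 5 + 16 * (f 6 + 16 * (f 7 + 16 * (f 8 + 16 * (f 9 + 16 * (f 10 +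
    16 * f 11)))))))))) := rfl

theorem code_eq_frameCode {p : Perm (Fin 12)} (h : p ∈ signedPerms) (h0 : p 0 = 0) :
    code p = frameCode (p 1) (p 2) (p 3) (p 4) (p 5) := by
  have h6 : ∀ k l, l = k + 6 → (p l : ℕ) = (p k + 6) % 12 := by
    rintro k _ rfl
    rw [h k, Fin.val_add]
    rfl
  have e6 := h6 0 6 rfl
  have e7 := h6 1 7 rfl
  have e8 := h6 2 8 rfl
  have e9 := h6 3 9 rfl
  have e10 := h6 4 10 rfl
  have e11 := h6 5 11 rfl
  rewrite [code_apply, e6, e7, e8, e9, e10, e11, h0]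
  exact Nat.zero_add _
-- A signed permutation permutes the axes, and the axes of 0, 1, 2 are kept; the images of 3, 4, 5
-- therefore lie on distinct axes among those of 3, 4, 5. Axes are residues modulo 6.
theorem code_mem_frameCodes_of_mem {p : Perm (Fin 12)} (hp : p ∈ frameStab) :
    code p ∈ frameCodes := by
  obtain ⟨h, h0, h1, h2⟩ := hp
  have hval : ∀ k l : Fin 12, SameAxis k l ↔ (k : ℕ) % 6 = l % 6 := by decide
  have hne : ∀ k l : Fin 12, ¬ SameAxis k l → (p k : ℕ) % 6 ≠ p l % 6 := by
    intro k l hkl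
    rwa [← sameAxis_apply h, hval] at hkl
  rw [hval] at h1 h2
  have h0' : (p 0 : ℕ) = 0 := congrArg Fin.val h0
  have e1 : ((1 : Fin 12) : ℕ) = 1 := rfl
  have e2 : ((2 : Fin 12) : ℕ) = 2 := rfl
  rw [e1] at h1
  rw [e2] at h2
  have l1 := (p 1).2
  have l2 := (p 2).2
  have aux : ∀ k : Fin 12, ¬ SameAxis k 0 → ¬ SameAxis k 1 → ¬ SameAxis k 2 →
      (p k : ℕ) ∈ [3, 4, 5, 9, 10, 11] := by
    intro k hk0 hk1 hk2
    have n0 := hne _ _ hk0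
    have n1 := hne _ _ hk1
    have n2 := hne _ _ hk2
    have l := (p k).2
    simp only [List.mem_cons, List.not_mem_nil, or_false]
    omega
  rw [code_eq_frameCode h h0]
  simp only [frameCodes, List.mem_flatMap, List.mem_map, List.mem_filter, Bool.and_eq_true,
    bne_iff_ne]
  refine ⟨p 1, ?_, p 2, ?_, p 3, aux 3 (by decide) (by decide) (by decide),
    p 4, ⟨aux 4 (by decide) (by decide) (by decide), hne _ _ (by decide)⟩,
    p 5, ⟨aux 5 (by decide) (by decide) (by decide), hne _ _ (by decide), hne _ _ (by decide)⟩, rfl⟩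
  · simp only [List.mem_cons, List.not_mem_nil, or_false]
    omega
  · simp only [List.mem_cons, List.not_mem_nil, or_false]
    omega

theorem exists_of_mem_frameCodes : ∀ c ∈ frameCodes, ∃ p : Perm (Fin 12), code p = c := by
  have h1 : ∀ c ∈ frameCodes, c = ofDigits (digit c) := by decide +kernel
  have h2 : ∀ c ∈ frameCodes, ∀ k < 12, digit c k < 12 := by decide +kernel
  have h3 : ∀ c ∈ frameCodes, ∀ k < 12, ∀ l < k, digit c k ≠ digit c l := by decide +kernel
  exact fun c hc => exists_perm_code c (h1 c hc) (h2 c hc) (h3 c hc)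

theorem code_mem_frameCodes {p : Perm (Fin 12)} : code p ∈ frameCodes ↔ p ∈ frameStab := by
  refine ⟨fun h => ?_, code_mem_frameCodes_of_mem⟩
  have h0 : ∀ c ∈ frameCodes, digit c 0 = 0 ∧ (digit c 1 = 1 ∨ digit c 1 = 7) ∧
      (digit c 2 = 2 ∨ digit c 2 = 8) := by decide +kernel
  have h6 : ∀ c ∈ frameCodes, ∀ k : Fin 12,
      digit c (k + 6 : Fin 12) = (digit c k + 6) % 12 := by decide +kernel
  have hd := digit_code p
  obtain ⟨e0, e1, e2⟩ := h0 _ h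
  have hs := h6 _ h
  have f0 := hd 0
  have f1 := hd 1
  have f2 := hd 2
  refine ⟨fun k => Fin.ext ?_, Fin.ext ?_, ?_, ?_⟩
  · rw [Fin.val_add, ← hd, ← hd, hs]
    rfl
  · rw [← f0]; exact e0
  · unfold SameAxis
    simp only [Fin.ext_iff, ← f1]
    exact e1
  · unfold SameAxis
    simp only [Fin.ext_iff, ← f2]
    exact e2

theorem frameCodes_nodup : frameCodes.Nodup := by decide +kernel

/-! ### Orders of intersections with conjugates of the icosahedral group -/

/-- Evaluates `f` at `n` after `n` has been reduced to a numeral. -/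
def force {α : Type} (n : ℕ) (f : ℕ → α) : α := Nat.rec (f 0) (fun k _ => f (Nat.succ k)) n

theorem force_eq {α : Type} (n : ℕ) (f : ℕ → α) : force n f = f n := by
  cases n <;> rfl

/-- The last six hexadecimal digits of the code of a conjugate `a * g * b`, where `a` is the inverse
of `b`. -/
def conjCode (a g b : ℕ) : ℕ :=
  (fun f : ℕ → ℕ => Nat.add (f 0) (Nat.mul 16 (Nat.add (f 1) (Nat.mul 16 (Nat.add (f 2)
    (Nat.mul 16 (Nat.add (f 3) (Nat.mul 16 (Nat.add (f 4) (Nat.mul 16 (f 5)))))))))))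
  fun k => digit a (digit g (digit b k))

/-- The number of rotations in the conjugate of the icosahedral group by the inverse of the
permutation with code `t`. -/
def interCount (t : ℕ) : ℕ :=
  force t fun t => force (codeInv t) fun u => icoCodes.countP fun g =>
    force (conjCode u g t) fun x => icoCodes.any fun c => Nat.beq x (Nat.mod c 16777216)

theorem code_mod (p : Perm (Fin 12)) : code p % 16 ^ 6 =
    p 0 + 16 * (p 1 + 16 * (p 2 + 16 * (p 3 + 16 * (p 4 + 16 * p 5)))) := by
  rewrite [code_apply]
  have h0 := (p 0).2
  have h1 := (p 1).2
  have h2 := (p 2).2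
  have h3 := (p 3).2
  have h4 := (p 4).2
  have h5 := (p 5).2
  omega

theorem conjCode_eq (a g b : Perm (Fin 12)) :
    conjCode (code a) (code g) (code b) = code (a * g * b : Perm (Fin 12)) % 16 ^ 6 := by
  have h : ∀ k : Fin 12, digit (code a) (digit (code g) (digit (code b) k)) =
      ((a * g * b : Perm (Fin 12)) k : ℕ) := by
    intro k
    rw [digit_code, digit_code, digit_code]
    rfl
  rw [code_mod, ← h, ← h, ← h, ← h, ← h, ← h]
  rfl

/-- The last six digits are the images of the vertices 0, …, 5, and the other six images are the
opposite vertices. This is why `conjCode` may stop after six digits. -/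
theorem eq_of_code_mod_eq {p q : Perm (Fin 12)} (hp : p ∈ signedPerms) (hq : q ∈ signedPerms)
    (h : code p % 16 ^ 6 = code q % 16 ^ 6) : p = q := by
  have hd : ∀ p : Perm (Fin 12), ∀ k : Fin 12, (k : ℕ) < 6 →
      (p k : ℕ) = digit (code p % 16 ^ 6) k := by
    intro p k hk
    rw [← digit_code, digit_eq, digit_eq]
    generalize code p = c
    generalize (k : ℕ) = k at hk
    interval_cases k <;> omega
  have h1 : ∀ k : Fin 12, (k : ℕ) < 6 → p k = q k :=
    fun k hk => Fin.ext (by rw [hd p k hk, hd q k hk, h])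
  refine Equiv.ext fun k => ?_
  by_cases hk : (k : ℕ) < 6
  · exact h1 k hk
  · have hk' : ((k + 6 : Fin 12) : ℕ) < 6 := by
      rw [Fin.val_add]
      have := k.2
      change (k + 6 : ℕ) % 12 < 6
      omega
    rw [← add_six_add_six k, hp, hq, h1 _ hk']

theorem ncard_inter_conj {t : Perm (Fin 12)} (ht : t ∈ signedPerms) :
    {g | g ∈ icosahedralGroup ∧ t⁻¹ * g * t ∈ icosahedralGroup}.ncard = interCount (code t) := by
  simp only [interCount, force_eq]
  refine ncard_ico _ _ fun p => ?_
  rw [← code_inv, conjCode_eq, List.any_eq_true, Set.mem_ofPred_eq]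
  refine and_congr_right fun hp => ?_
  constructor
  · intro h
    exact ⟨_, code_mem_icoCodes.2 h, Nat.beq_refl _⟩
  · rintro ⟨c, hc, h⟩
    obtain ⟨q, hq, rfl⟩ := exists_of_mem_icoCodes hc
    rw [eq_of_code_mod_eq (mul_mem (mul_mem (inv_mem ht) (icosahedralGroup_le hp)) ht)
      (icosahedralGroup_le hq) (Nat.eq_of_beq_eq_true h)]
    exact hq

theorem ncard_frameStab_interCount (n : ℕ) :
    {t | t ∈ frameStab ∧
      {g | g ∈ icosahedralGroup ∧ t⁻¹ * g * t ∈ icosahedralGroup}.ncard = n}.ncard =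
    (frameCodes.map interCount).count n := by
  rw [List.count, List.countP_map]
  refine ncard_of_codes _ frameCodes_nodup exists_of_mem_frameCodes _ _ fun p => ?_
  rw [code_mem_frameCodes, Set.mem_ofPred_eq]
  refine and_congr_right fun hp => ?_
  rw [Function.comp_apply, beq_iff_eq, ← ncard_inter_conj hp.1]

/-- The count is 2 · 2 · (2³ · 3!): two signs for the axes of 1 and 2, and arbitrary signed
permutations of the remaining three axes. -/
theorem card_frameStab : Nat.card frameStab = 192 :=
  (ncard_of_codes _ frameCodes_nodup exists_of_mem_frameCodes frameStab (fun _ => true) fun p => by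
    rw [code_mem_frameCodes]; simp).trans (by decide +kernel)

/-- The values of `interCount` on `frameCodes`. -/
def interCounts : List ℕ := [
  60, 10, 4, 2, 10, 4, 2, 4, 4, 2, 3, 1, 2, 1, 1, 2, 3, 1, 4, 2, 1, 2, 2, 1,
  10, 4, 2, 1, 4, 6, 1, 2, 2, 1, 1, 2, 4, 2, 2, 12, 1, 2, 2, 4, 2, 12, 1, 2,
  10, 4, 2, 1, 4, 6, 1, 2, 2, 1, 1, 3, 1, 3, 2, 1, 1, 2, 2, 1, 2, 4, 12, 2,
  4, 6, 1, 3, 6, 4, 3, 1, 1, 3, 2, 1, 2, 1, 4, 2, 3, 1, 1, 2, 1, 2, 2, 4,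
  10, 4, 2, 1, 4, 6, 1, 2, 2, 12, 1, 2, 1, 2, 2, 4, 1, 2, 2, 1, 3, 1, 1, 3,
  4, 6, 1, 3, 6, 4, 3, 1, 1, 2, 3, 1, 2, 4, 1, 2, 2, 4, 1, 2, 1, 2, 3, 1,
  4, 6, 4, 2, 6, 4, 2, 12, 1, 2, 2, 1, 3, 1, 4, 2, 2, 4, 1, 3, 1, 2, 2, 1,
  6, 4, 2, 1, 4, 10, 1, 2, 3, 1, 1, 3, 1, 2, 2, 1, 1, 2, 3, 1, 3, 1, 1, 2]

/-- This computation yields all the degrees. The single entry 60 comes from the identity; it also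
shows that nothing else in `frameStab` normalizes the icosahedral group. -/
theorem map_interCount : frameCodes.map interCount = interCounts := by
  have h : (frameCodes.map interCount == interCounts) = true := by decide +kernel
  exact beq_iff_eq.1 h

/-! ### The normalizer of the icosahedral group -/

/-- A signed permutation that normalizes the icosahedral group and generates the normalizer
modulo the icosahedral group. -/
def outerPerm : Perm (Fin 12) := c[1, 7] * c[2, 9, 10, 5] * c[3, 4, 11, 8]

theorem outerPerm_mem_signedPerms : outerPerm ∈ signedPerms := by
  rw [mem_signedPerms]; decide +kernel

/-- It suffices that conjugation sends the two generators into the group: by finiteness the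
inclusion of the conjugate is an equality. -/
theorem outerPerm_mem_normalizer : outerPerm ∈ Subgroup.normalizer (icosahedralGroup : Set (Perm (Fin 12))) := by
  refine Subgroup.mem_normalizer_fintype fun x hx => ?_
  have h : icosahedralGroup ≤ icosahedralGroup.comap (MulAut.conj outerPerm).toMonoidHom := by
    refine (Subgroup.closure_le _).2 ?_
    rintro y (rfl | rfl)
    · change outerPerm * g2 * outerPerm⁻¹ ∈ icosahedralGroup
      rw [← code_mem_icoCodes]
      decide +kernel
    · change outerPerm * g3 * outerPerm⁻¹ ∈ icosahedralGroup
      rw [← code_mem_icoCodes]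
      decide +kernel
  exact h hx

/-- Rotations are transitive on the vertices, and the five rotations about a vertex permute the
other five axes cyclically. -/
theorem exists_rotation (v a : Fin 12) (h : ¬ SameAxis v a) :
    ∃ g ∈ icosahedralGroup, g 0 = v ∧ SameAxis (g 1) a := by
  have key : ∀ v a : Fin 12, ¬ SameAxis v a →
      ∃ c ∈ icoCodes, digit c 0 = v ∧ digit c 1 % 6 = a % 6 := by decide +kernel
  obtain ⟨c, hc, h0, h1⟩ := key v a h
  obtain ⟨p, hp, rfl⟩ := exists_of_mem_icoCodes hc
  have hval : ∀ k l : Fin 12, SameAxis k l ↔ (k : ℕ) % 6 = l % 6 := by decide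
  refine ⟨p, hp, Fin.ext ?_, (hval _ _).2 ?_⟩
  · rw [← digit_code]; exact h0
  · rw [← digit_code]; exact h1

/-- Modulo the normalizer of the icosahedral group every signed permutation is in `frameStab`. -/
theorem exists_mul_mem_frameStab {c : Perm (Fin 12)} (hc : c ∈ signedPerms) :
    ∃ n ∈ Subgroup.normalizer (icosahedralGroup : Set (Perm (Fin 12))), n ∈ signedPerms ∧
      c * n ∈ frameStab := by
  have hc' := inv_mem hc
  -- This choice makes `c * g` fix the vertex 0 and keep the axis of 1.
  obtain ⟨g, hg, h0, h1⟩ := exists_rotation (c⁻¹ 0) (c⁻¹ 1)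
    (by rw [sameAxis_apply hc']; decide)
  have hcg : c * g ∈ signedPerms := mul_mem hc (icosahedralGroup_le hg)
  have e0 : (c * g) 0 = 0 := by rw [Perm.mul_apply, h0]; exact c.apply_symm_apply 0
  have e1 : SameAxis ((c * g) 1) 1 := by
    rw [Perm.mul_apply, ← sameAxis_apply hc']
    simpa using h1
  -- `outerPerm` permutes the four remaining axes cyclically, so one of its powers takes the axis of
  -- 2 to the one that `c * g` sends to the axis of 2.
  have key : ∀ b : Fin 12, ¬ SameAxis b 0 → ¬ SameAxis b 1 →
      ∃ i : Fin 4, (outerPerm ^ (i : ℕ)) 0 = 0 ∧ SameAxis ((outerPerm ^ (i : ℕ)) 1) 1 ∧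
        SameAxis ((outerPerm ^ (i : ℕ)) 2) b := by decide +kernel
  have hb : ∀ k, SameAxis ((c * g) k) k → ¬ SameAxis k 2 → ¬ SameAxis ((c * g)⁻¹ 2) k := by
    intro k hk hk2 h
    have h2 : (c * g) ((c * g)⁻¹ 2) = 2 := (c * g).apply_symm_apply 2
    rw [← sameAxis_apply hcg, h2] at h
    exact hk2 (h.trans hk).symm
  obtain ⟨i, i0, i1, i2⟩ := key ((c * g)⁻¹ 2) (hb 0 (Or.inl e0) (by decide)) (hb 1 e1 (by decide))
  refine ⟨g * outerPerm ^ (i : ℕ), mul_mem (Subgroup.le_normalizer hg)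
    (pow_mem outerPerm_mem_normalizer _),
    mul_mem (icosahedralGroup_le hg) (pow_mem outerPerm_mem_signedPerms _), ?_⟩
  rw [← mul_assoc]
  refine ⟨mul_mem hcg (pow_mem outerPerm_mem_signedPerms _), ?_, ?_, ?_⟩
  · rw [Perm.mul_apply, i0, e0]
  · exact ((sameAxis_apply hcg).2 i1).trans e1
  · rw [← sameAxis_apply hcg] at i2
    simpa using i2

/-- A normalizing `t` has an intersection of order 60, and the table contains 60 only once; the
identity already accounts for that entry. -/
theorem eq_one_of_mem_frameStab_of_mem_normalizer {t : Perm (Fin 12)} (ht : t ∈ frameStab)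
    (h : t ∈ Subgroup.normalizer (icosahedralGroup : Set (Perm (Fin 12)))) : t = 1 := by
  have h60 := ncard_frameStab_interCount 60
  rw [map_interCount, show interCounts.count 60 = 1 by decide +kernel, Set.ncard_eq_one] at h60
  obtain ⟨a, ha⟩ := h60
  have key : ∀ s ∈ frameStab, s ∈ Subgroup.normalizer (icosahedralGroup : Set (Perm (Fin 12))) →
      s = a := by
    intro s hs hn
    rw [← Set.mem_singleton_iff, ← ha]
    refine ⟨hs, ?_⟩
    have e : {g | g ∈ icosahedralGroup ∧ s⁻¹ * g * s ∈ icosahedralGroup} = icosahedralGroup := by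
      ext g
      refine and_iff_left_of_imp fun hg => ?_
      have := (Subgroup.mem_normalizer_iff.1 (inv_mem hn) g).1 hg
      simpa using this
    rw [e]
    exact card_icosahedralGroup
  exact (key t ht h).trans (key 1 (one_mem _) (one_mem _)).symm

/-! ### Signed permutations and integral orthogonal matrices -/

theorem coord_add_six : ∀ (i : Fin 6) (k : Fin 12), coord i (k + 6) = - coord i k := by decide

theorem coord_vtx : ∀ i j : Fin 6, coord i (vtx j) = if i = j then 1 else 0 := by decide

theorem coord_injective : ∀ k l : Fin 12, (∀ i, coord i k = coord i l) → k = l := by decide +kernel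

theorem exists_eq_vtx : ∀ k : Fin 12, ∃ j : Fin 6, k = vtx j ∨ k = vtx j + 6 := by decide

/-- The signed permutation matrices, as elements of `B₆`. -/
def signedRep : signedPerms →* B6 where
  toFun p := ⟨signedMatrix p.1, by
    rw [Matrix.mem_orthogonalGroup_iff]
    change signedMatrix p.1 * (signedMatrix p.1).transpose = 1
    rw [transpose_signedMatrix p.1 p.2, ← signedMatrix_mul _ _ p.2, mul_inv_cancel, signedMatrix_one]⟩
  map_one' := Subtype.ext signedMatrix_one
  map_mul' p q := Subtype.ext (signedMatrix_mul p.1 q.1 p.2)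

theorem signedRep_injective : Function.Injective signedRep := by
  intro p q h
  have h' : signedMatrix p.1 = signedMatrix q.1 := congrArg Subtype.val h
  refine Subtype.ext (Equiv.ext fun k => coord_injective _ _ fun i => ?_)
  rw [coord_eq _ p.2, coord_eq _ q.2, h']

/-- A nonzero integer has square at least 1, so exactly one coordinate is nonzero, and it is ±1. -/
theorem exists_coord_eq (w : Fin 6 → ℤ) (hw : ∑ i, w i * w i = 1) : ∃ k, ∀ i, coord i k = w i := by
  obtain ⟨j, hj⟩ : ∃ j, w j ≠ 0 := by
    by_contra! h
    simp [h] at hw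
  have h1 : 1 ≤ w j * w j := by
    rcases lt_or_gt_of_ne hj with h | h <;> nlinarith
  rw [← Finset.add_sum_erase _ _ (Finset.mem_univ j)] at hw
  have hnn : ∀ i ∈ Finset.univ.erase j, 0 ≤ w i * w i := fun i _ => mul_self_nonneg _
  have h0 : ∑ i ∈ Finset.univ.erase j, w i * w i = 0 :=
    le_antisymm (by omega) (Finset.sum_nonneg hnn)
  have hz : ∀ i, i ≠ j → w i = 0 := fun i hi =>
    mul_self_eq_zero.1 ((Finset.sum_eq_zero_iff_of_nonneg hnn).1 h0 i
      (Finset.mem_erase.2 ⟨hi, Finset.mem_univ i⟩))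
  have hj1 : w j * w j = 1 := by omega
  rcases mul_self_eq_one_iff.1 hj1 with h | h
  · refine ⟨vtx j, fun i => ?_⟩
    rw [coord_vtx]
    split_ifs with hij
    · rw [hij, h]
    · exact (hz i hij).symm
  · refine ⟨vtx j + 6, fun i => ?_⟩
    rw [coord_add_six, coord_vtx]
    split_ifs with hij
    · rw [hij, h]
    · rw [hz i hij, neg_zero]

/-- The columns of an integral orthogonal matrix are integral unit vectors, so the matrix maps the
vectors ±e_i among themselves. The induced map of vertices is injective because the transpose undoes
it. -/
theorem signedRep_surjective : Function.Surjective signedRep := by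
  intro A
  have hA : star A.1 * A.1 = 1 := (Matrix.mem_orthogonalGroup_iff' (Fin 6) ℤ).1 A.2
  have hA' : ∀ j l, ∑ i, A.1 i j * A.1 i l = if j = l then 1 else 0 := by
    intro j l
    have h := congrFun (congrFun hA j) l
    simpa [Matrix.mul_apply, Matrix.star_apply, Matrix.one_apply] using h
  have hcol : ∀ (i j : Fin 6), ∑ l, A.1 i l * coord l (vtx j) = A.1 i j := by
    intro i j
    simp [coord_vtx]
  have hex : ∀ k, ∃ k', ∀ i, coord i k' = ∑ l, A.1 i l * coord l k := by
    intro k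
    obtain ⟨j, rfl | rfl⟩ := exists_eq_vtx k
    · refine exists_coord_eq _ ?_
      simp only [hcol, hA', if_true]
    · refine exists_coord_eq _ ?_
      simp only [coord_add_six, mul_neg, Finset.sum_neg_distrib, hcol, neg_mul, neg_neg, hA', if_true]
  choose f hf using hex
  have hinv : ∀ k j, ∑ i, A.1 i j * coord i (f k) = coord j k := by
    intro k j
    simp only [hf, Finset.mul_sum]
    rw [Finset.sum_comm]
    simp only [← mul_assoc, ← Finset.sum_mul, hA']
    simp
  have hinj : Function.Injective f := by
    intro k l h
    refine coord_injective _ _ fun j => ?_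
    rw [← hinv, ← hinv l, h]
  have h6 : ∀ k, f (k + 6) = f k + 6 := by
    intro k
    refine coord_injective _ _ fun i => ?_
    rw [hf, coord_add_six, hf]
    simp only [coord_add_six, mul_neg, Finset.sum_neg_distrib]
  refine ⟨⟨Equiv.ofBijective f (Finite.injective_iff_bijective.1 hinj), h6⟩, Subtype.ext ?_⟩
  ext i j
  exact (hf (vtx j) i).trans (hcol i j)

/-- The group `B₆` as the group of signed permutations of the vertices. -/
noncomputable def signedEquiv : signedPerms ≃* B6 :=
  MulEquiv.ofBijective signedRep ⟨signedRep_injective, signedRep_surjective⟩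

theorem icosahedralRep_eq (p : icosahedralGroup) :
    icosahedralRep p = signedRep ⟨p.1, icosahedralGroup_le p.2⟩ := rfl

theorem icosahedralRep_injective : Function.Injective icosahedralRep := by
  intro p q h
  rw [icosahedralRep_eq, icosahedralRep_eq] at h
  have := congrArg Subtype.val (signedRep_injective h)
  exact Subtype.ext this

theorem signedRep_mem_hatI {p : signedPerms} : signedRep p ∈ hatI ↔ p.1 ∈ icosahedralGroup := by
  constructor
  · rintro ⟨q, hq⟩
    rw [icosahedralRep_eq] at hq
    rw [← signedRep_injective hq]
    exact q.2
  · intro h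
    exact ⟨⟨p.1, h⟩, rfl⟩

/-! ### Conjugates of subgroups -/

section Conj

variable {Γ : Type*} [Group Γ]

/-- The conjugate `g H g⁻¹` of a subgroup `H`. -/
abbrev conjBy (g : Γ) (H : Subgroup Γ) : Subgroup Γ := H.map (MulAut.conj g).toMonoidHom

theorem mem_conjBy {g x : Γ} {H : Subgroup Γ} : x ∈ conjBy g H ↔ g⁻¹ * x * g ∈ H := by
  constructor
  · rintro ⟨y, hy, rfl⟩
    simpa [mul_assoc] using hy
  · intro h
    exact ⟨_, h, by simp [mul_assoc]⟩

theorem conjBy_conjBy (g h : Γ) (H : Subgroup Γ) : conjBy g (conjBy h H) = conjBy (g * h) H := by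
  ext x
  simp only [mem_conjBy, mul_inv_rev, mul_assoc]

theorem conjBy_one (H : Subgroup Γ) : conjBy 1 H = H := by
  ext x
  simp

theorem conjBy_inv_conjBy (g : Γ) (H : Subgroup Γ) : conjBy g⁻¹ (conjBy g H) = H := by
  rw [conjBy_conjBy, inv_mul_cancel, conjBy_one]

theorem conjBy_injective (g : Γ) : Function.Injective (conjBy g) :=
  Function.LeftInverse.injective (conjBy_inv_conjBy g)

theorem conjBy_inf (g : Γ) (H K : Subgroup Γ) : conjBy g (H ⊓ K) = conjBy g H ⊓ conjBy g K := by
  ext x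
  simp only [mem_conjBy, Subgroup.mem_inf]

theorem card_conjBy (g : Γ) (H : Subgroup Γ) : Nat.card (conjBy g H) = Nat.card H :=
  Subgroup.card_map_of_injective (MulAut.conj g).injective

theorem conjBy_mem_conjClass {H K : Subgroup Γ} (g : Γ) (h : K ∈ conjClass H) :
    conjBy g K ∈ conjClass H := by
  obtain ⟨x, rfl⟩ := h
  exact ⟨g * x, conjBy_conjBy g x H⟩

theorem conjBy_eq_self {n : Γ} {H : Subgroup Γ} (hn : n ∈ Subgroup.normalizer (H : Set Γ)) :
    conjBy n H = H := by
  ext x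
  rw [mem_conjBy, Subgroup.mem_normalizer_iff.1 (inv_mem hn) x, inv_inv]

end Conj

/-! ### The class of the icosahedral group in `B₆` -/

theorem signedRep_mem_conjBy {c p : signedPerms} :
    signedRep p ∈ conjBy (signedRep c) hatI ↔ c.1⁻¹ * p.1 * c.1 ∈ icosahedralGroup := by
  rw [mem_conjBy, ← map_inv, ← map_mul, ← map_mul, signedRep_mem_hatI]
  rfl

/-- The class of the icosahedral group is parametrized by `frameStab`. -/
def frameClass (t : frameStab) : Subgroup B6 := conjBy (signedRep ⟨t.1, t.2.1⟩) hatI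

theorem range_frameClass : Set.range frameClass = crystClass := by
  ext K
  constructor
  · rintro ⟨t, rfl⟩
    exact ⟨_, rfl⟩
  · rintro ⟨g, rfl⟩
    obtain ⟨⟨c, hc⟩, rfl⟩ := signedRep_surjective g
    obtain ⟨n, hn, hn', ht⟩ := exists_mul_mem_frameStab hc
    refine ⟨⟨_, ht⟩, ?_⟩
    have hnorm : signedRep ⟨n, hn'⟩ ∈ Subgroup.normalizer (hatI : Set B6) := by
      rw [Subgroup.mem_normalizer_iff]
      intro x
      obtain ⟨p, rfl⟩ := signedRep_surjective x
      rw [← map_inv, ← map_mul, ← map_mul, signedRep_mem_hatI, signedRep_mem_hatI]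
      exact Subgroup.mem_normalizer_iff.1 hn p.1
    change conjBy (signedRep (⟨c, hc⟩ * ⟨n, hn'⟩)) hatI = conjBy (signedRep ⟨c, hc⟩) hatI
    rw [map_mul, ← conjBy_conjBy, conjBy_eq_self hnorm]

/-- Equal conjugates by `s` and `t` make `t⁻¹ * s` a normalizing element of `frameStab`, hence the
identity. -/
theorem frameClass_injective : Function.Injective frameClass := by
  intro s t h
  have h1 : t⁻¹ * s = 1 := by
    refine Subtype.ext (eq_one_of_mem_frameStab_of_mem_normalizer (t⁻¹ * s).2 ?_)
    have h2 := congrArg (conjBy (signedRep ⟨t.1, t.2.1⟩)⁻¹) h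
    unfold frameClass at h2
    rw [conjBy_inv_conjBy, conjBy_conjBy, ← map_inv, ← map_mul] at h2
    rw [← inv_mem_iff, Subgroup.mem_normalizer_iff]
    intro x
    have hmem : ∀ y ∈ icosahedralGroup, ((t⁻¹ * s : frameStab) : Perm (Fin 12))⁻¹ * y *
        ((t⁻¹ * s : frameStab) : Perm (Fin 12)) ∈ icosahedralGroup := by
      intro y hy
      have h3 : signedRep ⟨y, icosahedralGroup_le hy⟩ ∈ hatI := signedRep_mem_hatI.2 hy
      rw [← h2, signedRep_mem_conjBy] at h3
      exact h3
    have hn := Subgroup.mem_normalizer_fintype (S := (icosahedralGroup : Set (Perm (Fin 12))))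
      (x := ((t⁻¹ * s : frameStab) : Perm (Fin 12))⁻¹) (by simpa using hmem)
    exact Subgroup.mem_normalizer_iff.1 hn x
  exact (inv_mul_eq_one.1 h1).symm

theorem crystClass_encard : crystClass.encard = 192 := by
  rw [← range_frameClass, ← Set.image_univ, frameClass_injective.encard_image, Set.encard_univ,
    ENat.card_eq_coe_natCard, card_frameStab]
  rfl

theorem card_inf_frameClass (t : frameStab) : Nat.card (hatI ⊓ frameClass t : Subgroup B6) =
    {g | g ∈ icosahedralGroup ∧ t.1⁻¹ * g * t.1 ∈ icosahedralGroup}.ncard := by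
  let S : Set signedPerms := {p | p.1 ∈ icosahedralGroup ∧ t.1⁻¹ * p.1 * t.1 ∈ icosahedralGroup}
  have h1 : {g | g ∈ icosahedralGroup ∧ t.1⁻¹ * g * t.1 ∈ icosahedralGroup} = Subtype.val '' S := by
    ext g
    constructor
    · intro h
      exact ⟨⟨g, icosahedralGroup_le h.1⟩, h, rfl⟩
    · rintro ⟨p, hp, rfl⟩
      exact hp
  have h2 : ((hatI ⊓ frameClass t : Subgroup B6) : Set B6) = signedRep '' S := by
    ext x
    obtain ⟨p, rfl⟩ := signedRep_surjective x
    rw [signedRep_injective.mem_set_image, SetLike.mem_coe, Subgroup.mem_inf, signedRep_mem_hatI]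
    exact and_congr_right fun _ => signedRep_mem_conjBy
  rw [h1, Set.ncard_image_of_injective _ Subtype.val_injective,
    ← Set.ncard_image_of_injective S signedRep_injective, ← h2]
  rfl

theorem ncard_crystClass_card_inf_hatI (n : ℕ) :
    {K | K ∈ crystClass ∧ Nat.card (hatI ⊓ K : Subgroup B6) = n}.ncard = interCounts.count n := by
  rw [← map_interCount, ← ncard_frameStab_interCount]
  let S : Set frameStab :=
    {t | {g | g ∈ icosahedralGroup ∧ t.1⁻¹ * g * t.1 ∈ icosahedralGroup}.ncard = n}
  have h1 : {t | t ∈ frameStab ∧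
      {g | g ∈ icosahedralGroup ∧ t⁻¹ * g * t ∈ icosahedralGroup}.ncard = n} =
      Subtype.val '' S := by
    ext t
    constructor
    · intro h
      exact ⟨⟨t, h.1⟩, h.2, rfl⟩
    · rintro ⟨p, hp, rfl⟩
      exact ⟨p.2, hp⟩
  have h2 : {K | K ∈ crystClass ∧ Nat.card (hatI ⊓ K : Subgroup B6) = n} = frameClass '' S := by
    ext K
    rw [← range_frameClass]
    constructor
    · rintro ⟨⟨t, rfl⟩, h⟩
      exact ⟨t, (card_inf_frameClass t).symm.trans h, rfl⟩
    · rintro ⟨t, ht, rfl⟩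
      exact ⟨⟨t, rfl⟩, (card_inf_frameClass t).trans ht⟩
  rw [h1, h2, Set.ncard_image_of_injective _ Subtype.val_injective,
    Set.ncard_image_of_injective _ frameClass_injective]

/-- Relations between subgroups that are invariant under conjugation relate every member of the
class of the icosahedral group to the same number of members. -/
theorem ncard_crystClass_rel (R : Subgroup B6 → Subgroup B6 → Prop)
    (hR : ∀ g H K, R H K → R (conjBy g H) (conjBy g K)) {H : Subgroup B6} (hH : H ∈ crystClass) :
    {K | K ∈ crystClass ∧ R H K}.ncard = {K | K ∈ crystClass ∧ R hatI K}.ncard := by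
  obtain ⟨g, rfl⟩ := hH
  have h : {K | K ∈ crystClass ∧ R (conjBy g hatI) K} =
      conjBy g '' {K | K ∈ crystClass ∧ R hatI K} := by
    ext K
    constructor
    · rintro ⟨hK, h⟩
      refine ⟨conjBy g⁻¹ K, ⟨conjBy_mem_conjClass _ hK, ?_⟩, ?_⟩
      · have := hR g⁻¹ _ _ h
        rwa [conjBy_inv_conjBy] at this
      · simpa using conjBy_inv_conjBy g⁻¹ K
    · rintro ⟨K, ⟨hK, h⟩, rfl⟩
      exact ⟨conjBy_mem_conjClass _ hK, hR g _ _ h⟩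
  exact (congrArg Set.ncard h).trans (Set.ncard_image_of_injective _ (conjBy_injective g))

theorem ncard_crystClass_card_inf {H : Subgroup B6} (hH : H ∈ crystClass) (n : ℕ) :
    {K | K ∈ crystClass ∧ Nat.card (H ⊓ K : Subgroup B6) = n}.ncard = interCounts.count n := by
  rw [← ncard_crystClass_card_inf_hatI]
  refine ncard_crystClass_rel (fun H K => Nat.card (H ⊓ K : Subgroup B6) = n) ?_ hH
  intro g H K h
  rw [← conjBy_inf, card_conjBy, h]

theorem degree_subgroupGraph (G : Subgroup icosahedralGroup) (H : crystClass) :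
    (subgroupGraph G).degree H = {K | K ∈ crystClass ∧
      (H.1 ≠ K ∧ ∃ P ∈ conjClass (subgroupRep G), P = H.1 ⊓ K)}.ncard := by
  have h : {K | K ∈ crystClass ∧ (H.1 ≠ K ∧ ∃ P ∈ conjClass (subgroupRep G), P = H.1 ⊓ K)} =
      Subtype.val '' (subgroupGraph G).neighborSet H := by
    ext K
    constructor
    · rintro ⟨hK, hne, h⟩
      exact ⟨⟨K, hK⟩, ⟨fun h' => hne (congrArg Subtype.val h'), h⟩, rfl⟩
    · rintro ⟨K, hK, rfl⟩
      exact ⟨K.2, fun h' => hK.1 (Subtype.ext h'), hK.2⟩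
  rw [h, Set.ncard_image_of_injective _ Subtype.val_injective,
    ← SimpleGraph.card_neighborSet_eq_degree, ← Nat.card_eq_fintype_card]
  rfl

/-- `B6` acts on the graph by conjugation, transitively on the vertices and preserving adjacency. -/
theorem isRegular_subgroupGraph (G : Subgroup icosahedralGroup) :
    ∃ d : ℕ, (subgroupGraph G).IsRegularOfDegree d := by
  refine ⟨{K | K ∈ crystClass ∧
    (hatI ≠ K ∧ ∃ P ∈ conjClass (subgroupRep G), P = hatI ⊓ K)}.ncard, fun H => ?_⟩
  rw [degree_subgroupGraph]
  refine ncard_crystClass_rel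
    (fun H K => H ≠ K ∧ ∃ P ∈ conjClass (subgroupRep G), P = H ⊓ K) ?_ H.2
  rintro g H K ⟨hne, P, hP, rfl⟩
  exact ⟨(conjBy_injective g).ne hne, _, conjBy_mem_conjClass g hP, conjBy_inf g H K⟩

/-! ### Subgroups of the icosahedral group -/

section General

variable {Γ : Type*} [Group Γ] [Finite Γ]

/-- A subgroup that meets its conjugates trivially is normalized by every group of less than the
square of its order in which it is contained. -/
theorem le_normalizer_of_card_lt_sq {P G : Subgroup Γ} (hPG : P ≤ G)
    (hcard : Nat.card G < Nat.card P ^ 2)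
    (hP : ∀ x, conjBy x P ⊓ P = ⊥ ∨ x ∈ Subgroup.normalizer (P : Set Γ)) :
    G ≤ Subgroup.normalizer (P : Set Γ) := by
  intro x hx
  refine (hP x).resolve_left fun h => ?_
  -- If `P` and its conjugate met trivially, their products would be |P|² distinct elements of `G`.
  have hinj := Subgroup.mul_injective_of_disjoint (disjoint_iff.2 h)
  have hQ : conjBy x P ≤ G := by
    rintro _ ⟨y, hy, rfl⟩
    exact mul_mem (mul_mem hx (hPG hy)) (inv_mem hx)
  have hle : Nat.card (conjBy x P × P) ≤ Nat.card G :=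
    Nat.card_le_card_of_injective
      (fun g => (⟨g.1 * g.2, mul_mem (hQ g.1.2) (hPG g.2.2)⟩ : G))
      fun a b hab => hinj (congrArg Subtype.val hab)
  rw [Nat.card_prod, card_conjBy, ← sq] at hle
  exact absurd hcard (not_lt.2 hle)

/-- Every subgroup of order divisible by the order of a Sylow subgroup `P` contains `P`, up to
conjugation. -/
theorem exists_le_conjBy {p k : ℕ} [Fact p.Prime] (hk : (Nat.card Γ).factorization p = k)
    {P G : Subgroup Γ} (hP : Nat.card P = p ^ k) (hG : p ^ k ∣ Nat.card G) :
    ∃ g, P ≤ conjBy g G := by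
  obtain ⟨K, hK⟩ := Sylow.exists_subgroup_card_pow_prime p hG
  have hK' : Nat.card (K.map G.subtype) = p ^ k :=
    (Subgroup.card_map_of_injective G.subtype_injective).trans hK
  subst hk
  obtain ⟨g, hg⟩ := MulAction.exists_smul_eq Γ (Sylow.ofCard (K.map G.subtype) hK')
    (Sylow.ofCard P hP)
  refine ⟨g, ?_⟩
  have h : conjBy g (K.map G.subtype) = P := by
    have h := congrArg Sylow.toSubgroup hg
    rw [Sylow.coe_subgroup_smul] at h
    exact h
  rw [← h]
  refine Subgroup.map_mono ?_
  rintro _ ⟨y, -, rfl⟩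
  exact y.2

/-- Subgroups of the same order that are conjugate into each other. -/
theorem exists_conjBy_eq {P G : Subgroup Γ} (h : ∃ g, P ≤ conjBy g G)
    (hcard : Nat.card G ≤ Nat.card P) : ∃ g, conjBy g G = P := by
  obtain ⟨g, hg⟩ := h
  exact ⟨g, (Subgroup.eq_of_le_of_card_ge hg (by rwa [card_conjBy])).symm⟩

/-- Up to conjugation, a subgroup of order divisible by the order of a Sylow subgroup `P` that meets
its conjugates trivially, and of order less than the square of that order, is contained in the
normalizer of `P`. -/
theorem exists_conjBy_le_normalizer {p k : ℕ} [Fact p.Prime]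
    (hk : (Nat.card Γ).factorization p = k) {P G : Subgroup Γ} (hP : Nat.card P = p ^ k)
    (hTI : ∀ x, conjBy x P ⊓ P = ⊥ ∨ x ∈ Subgroup.normalizer (P : Set Γ))
    (hG : p ^ k ∣ Nat.card G) (hlt : Nat.card G < (p ^ k) ^ 2) :
    ∃ g, conjBy g G ≤ Subgroup.normalizer (P : Set Γ) := by
  obtain ⟨g, hg⟩ := exists_le_conjBy hk hP hG
  exact ⟨g, le_normalizer_of_card_lt_sq hg (by rwa [card_conjBy, hP]) hTI⟩

end General

/-! ### Sylow subgroups of the icosahedral group, their normalizers and conjugacy -/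

/-- The subgroup of the icosahedral group with the given codes. -/
def codeSubgroup (L : List ℕ) (h1 : code (1 : Perm (Fin 12)) ∈ L)
    (hmul : ∀ a ∈ L, ∀ b ∈ L, codeMul a b ∈ L) (hinv : ∀ a ∈ L, codeInv a ∈ L) :
    Subgroup icosahedralGroup where
  carrier := {p | code p.1 ∈ L}
  one_mem' := h1
  mul_mem' {p q} hp hq := by
    change code (p.1 * q.1 : Perm (Fin 12)) ∈ L
    rw [code_mul]
    exact hmul _ hp _ hq
  inv_mem' {p} hp := by
    change code (p.1⁻¹ : Perm (Fin 12)) ∈ L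
    rw [code_inv]
    exact hinv _ hp

theorem mem_codeSubgroup {L : List ℕ} {h1 : code (1 : Perm (Fin 12)) ∈ L}
    {hmul : ∀ a ∈ L, ∀ b ∈ L, codeMul a b ∈ L} {hinv : ∀ a ∈ L, codeInv a ∈ L}
    {p : icosahedralGroup} : p ∈ codeSubgroup L h1 hmul hinv ↔ code p.1 ∈ L := Iff.rfl

theorem card_ico_subgroup (G : Subgroup icosahedralGroup) (Q : ℕ → Bool)
    (h : ∀ p : icosahedralGroup, p ∈ G ↔ Q (code p.1) = true) : Nat.card G = icoCodes.countP Q := by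
  rw [← ncard_ico (Subtype.val '' (G : Set icosahedralGroup)) Q,
    Set.ncard_image_of_injective _ Subtype.val_injective]
  · rfl
  · intro p
    constructor
    · rintro ⟨q, hq, rfl⟩
      exact ⟨q.2, (h q).1 hq⟩
    · rintro ⟨hp, hQ⟩
      exact ⟨⟨p, hp⟩, (h ⟨p, hp⟩).2 hQ, rfl⟩

section CodeSubgroup

variable {L : List ℕ} {h1 : code (1 : Perm (Fin 12)) ∈ L}
  {hmul : ∀ a ∈ L, ∀ b ∈ L, codeMul a b ∈ L} {hinv : ∀ a ∈ L, codeInv a ∈ L}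

theorem card_codeSubgroup :
    Nat.card (codeSubgroup L h1 hmul hinv) = icoCodes.countP (· ∈ L) :=
  card_ico_subgroup _ _ fun p => by rw [decide_eq_true_iff]; rfl

theorem code_conj (x y : icosahedralGroup) :
    code (x * y * x⁻¹).1 = codeMul (codeMul (code x.1) (code y.1)) (codeInv (code x.1)) := by
  rw [← code_inv, ← code_mul, ← code_mul]
  rfl

theorem mem_normalizer_codeSubgroup (hL : ∀ a ∈ L, a ∈ icoCodes) {x : icosahedralGroup} :
    x ∈ Subgroup.normalizer (codeSubgroup L h1 hmul hinv : Set icosahedralGroup) ↔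
      ∀ a ∈ L, codeMul (codeMul (code x.1) a) (codeInv (code x.1)) ∈ L := by
  constructor
  · intro h a ha
    obtain ⟨p, hp, rfl⟩ := exists_of_mem_icoCodes (hL a ha)
    have h' := (Subgroup.mem_normalizer_iff.1 h ⟨p, hp⟩).1 (mem_codeSubgroup.2 ha)
    rwa [mem_codeSubgroup, code_conj] at h'
  · intro h
    refine Subgroup.mem_normalizer_fintype fun y hy => ?_
    rw [SetLike.mem_coe, mem_codeSubgroup] at hy ⊢
    rw [code_conj]
    exact h _ hy

theorem card_normalizer_codeSubgroup (hL : ∀ a ∈ L, a ∈ icoCodes) :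
    Nat.card (Subgroup.normalizer (codeSubgroup L h1 hmul hinv : Set icosahedralGroup)) =
      icoCodes.countP fun x => ∀ a ∈ L, codeMul (codeMul x a) (codeInv x) ∈ L :=
  card_ico_subgroup _ _ fun p => by
    rw [decide_eq_true_iff]; exact mem_normalizer_codeSubgroup hL

theorem conjBy_inf_codeSubgroup (hL : ∀ a ∈ L, a ∈ icoCodes)
    (hTI : ∀ x ∈ icoCodes, (∀ a ∈ L, codeMul (codeMul x a) (codeInv x) ∈ L) ∨
      ∀ a ∈ L, codeMul (codeMul x a) (codeInv x) ∈ L → a = code (1 : Perm (Fin 12)))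
    (x : icosahedralGroup) :
    conjBy x (codeSubgroup L h1 hmul hinv) ⊓ codeSubgroup L h1 hmul hinv = ⊥ ∨
      x ∈ Subgroup.normalizer (codeSubgroup L h1 hmul hinv : Set icosahedralGroup) := by
  rw [mem_normalizer_codeSubgroup hL]
  refine (hTI _ (code_mem_icoCodes.2 x.2)).symm.imp_left fun h => ?_
  rw [eq_bot_iff]
  rintro _ ⟨⟨y, hy, rfl⟩, hy'⟩
  have hy'' : code (x * y * x⁻¹).1 ∈ L := mem_codeSubgroup.1 hy'
  rw [code_conj] at hy''
  have := h _ (mem_codeSubgroup.1 hy) hy''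
  rw [code_inj] at this
  have hy1 : y = 1 := Subtype.ext this
  rw [hy1, map_one]
  exact one_mem _

end CodeSubgroup

/-- A Sylow `2`-subgroup of the icosahedral group. -/
def sylowTwo : Subgroup icosahedralGroup :=
  codeSubgroup [205163983024656, 89211851475366, 113467315034181, 4986816308091]
    (by decide +kernel) (by decide +kernel) (by decide +kernel)

/-- A Sylow `3`-subgroup of the icosahedral group. -/
def sylowThree : Subgroup icosahedralGroup :=
  codeSubgroup [205163983024656, 118142370388356, 182663268828981]
    (by decide +kernel) (by decide +kernel) (by decide +kernel)

/-- A Sylow `5`-subgroup of the icosahedral group, the stabilizer of the vertex `0`. -/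
def sylowFive : Subgroup icosahedralGroup :=
  codeSubgroup [205163983024656, 178231316083536, 38833593366336, 60770139351936, 135807773256336]
    (by decide +kernel) (by decide +kernel) (by decide +kernel)

theorem card_sylowTwo : Nat.card sylowTwo = 2 ^ 2 := card_codeSubgroup.trans (by decide +kernel)

theorem card_sylowThree : Nat.card sylowThree = 3 ^ 1 := card_codeSubgroup.trans (by decide +kernel)

theorem card_sylowFive : Nat.card sylowFive = 5 ^ 1 := card_codeSubgroup.trans (by decide +kernel)

/-- The three normalizers represent the orders 12, 6 and 10. Each order is below the square of the
Sylow order (12 < 16, 6 < 9, 10 < 25), as `exists_conjBy_le_normalizer` requires. -/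
theorem card_normalizer_sylowTwo :
    Nat.card (Subgroup.normalizer (sylowTwo : Set icosahedralGroup)) = 12 :=
  (card_normalizer_codeSubgroup (by decide +kernel)).trans (by decide +kernel)

theorem card_normalizer_sylowThree :
    Nat.card (Subgroup.normalizer (sylowThree : Set icosahedralGroup)) = 6 :=
  (card_normalizer_codeSubgroup (by decide +kernel)).trans (by decide +kernel)

theorem card_normalizer_sylowFive :
    Nat.card (Subgroup.normalizer (sylowFive : Set icosahedralGroup)) = 10 :=
  (card_normalizer_codeSubgroup (by decide +kernel)).trans (by decide +kernel)

theorem conjBy_inf_sylowTwo : ∀ x, conjBy x sylowTwo ⊓ sylowTwo = ⊥ ∨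
    x ∈ Subgroup.normalizer (sylowTwo : Set icosahedralGroup) :=
  conjBy_inf_codeSubgroup (by decide +kernel) (by decide +kernel)

theorem conjBy_inf_sylowThree : ∀ x, conjBy x sylowThree ⊓ sylowThree = ⊥ ∨
    x ∈ Subgroup.normalizer (sylowThree : Set icosahedralGroup) :=
  conjBy_inf_codeSubgroup (by decide +kernel) (by decide +kernel)

theorem conjBy_inf_sylowFive : ∀ x, conjBy x sylowFive ⊓ sylowFive = ⊥ ∨
    x ∈ Subgroup.normalizer (sylowFive : Set icosahedralGroup) :=
  conjBy_inf_codeSubgroup (by decide +kernel) (by decide +kernel)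

theorem factorization_two : (Nat.card icosahedralGroup).factorization 2 = 2 := by
  rw [card_icosahedralGroup]; decide +kernel

theorem factorization_three : (Nat.card icosahedralGroup).factorization 3 = 1 := by
  rw [card_icosahedralGroup]; decide +kernel

theorem factorization_five : (Nat.card icosahedralGroup).factorization 5 = 1 := by
  rw [card_icosahedralGroup]; decide +kernel

/-- The icosahedral group has no subgroups of order `15` and `20`. -/
theorem card_le_ten_of_five_dvd {G : Subgroup icosahedralGroup} (h5 : 5 ∣ Nat.card G)
    (hlt : Nat.card G < 25) : Nat.card G ≤ 10 := by
  have : Fact (Nat.Prime 5) := ⟨Nat.prime_five⟩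
  obtain ⟨g, hg⟩ := exists_conjBy_le_normalizer factorization_five card_sylowFive
    conjBy_inf_sylowFive (by simpa using h5) (by simpa using hlt)
  have := Subgroup.card_le_of_le hg
  rwa [card_conjBy, card_normalizer_sylowFive] at this

/-- The two-fold rotations are conjugate. -/
theorem exists_conj_eq_g2 (x : icosahedralGroup) (hx : x * x = 1) (hx1 : x ≠ 1) :
    ∃ g : icosahedralGroup, (g * x * g⁻¹).1 = g2 := by
  have key : ∀ a ∈ icoCodes, codeMul a a = code (1 : Perm (Fin 12)) →
      a = code (1 : Perm (Fin 12)) ∨ ∃ g ∈ icoCodes, codeMul (codeMul g a) (codeInv g) = code g2 := by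
    rw [code_one, code_g2]; decide +kernel
  have hxx : code (x.1 * x.1 : Perm (Fin 12)) = code (1 : Perm (Fin 12)) := by
    rw [code_inj]; exact congrArg Subtype.val hx
  rw [code_mul] at hxx
  rcases key _ (code_mem_icoCodes.2 x.2) hxx with h | ⟨g, hg, h⟩
  · rw [code_inj] at h
    exact absurd (Subtype.ext h) hx1
  · obtain ⟨p, hp, rfl⟩ := exists_of_mem_icoCodes hg
    refine ⟨⟨p, hp⟩, ?_⟩
    rw [← code_inj, code_conj]
    exact h

/-- Order 2 is not a Sylow order here. Instead, both groups are conjugate to the one generated by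
`g2`, since all involutions are conjugate. -/
theorem exists_conjBy_eq_of_card_two {G K : Subgroup icosahedralGroup} (hG : Nat.card G = 2)
    (hK : Nat.card K = 2) : ∃ g, conjBy g G = K := by
  have key : ∀ G : Subgroup icosahedralGroup, Nat.card G = 2 →
      ∃ g, ∃ x ∈ conjBy g G, x.1 = g2 := by
    intro G hG
    obtain ⟨y, hy, -⟩ := (Nat.card_eq_two_iff' (1 : G)).1 hG
    have hyy : y * y = 1 := by
      rw [← sq, ← hG]; exact pow_card_eq_one'
    obtain ⟨g, hg⟩ := exists_conj_eq_g2 y.1 (congrArg Subtype.val hyy)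
      (fun h => hy (Subtype.ext h))
    exact ⟨g, _, ⟨y.1, y.2, rfl⟩, hg⟩
  have key2 : ∀ G : Subgroup icosahedralGroup, Nat.card G = 2 →
      ∀ x ∈ G, x.1 = g2 → G = Subgroup.zpowers x := by
    intro G hG x hx hx2
    have hle : Subgroup.zpowers x ≤ G := by rwa [Subgroup.zpowers_le]
    refine (Subgroup.eq_of_le_of_card_ge hle ?_).symm
    have hne : x ≠ 1 := by
      rintro rfl
      exact absurd hx2 (by decide +kernel)
    have : Nontrivial (Subgroup.zpowers x) :=
      ⟨⟨⟨x, Subgroup.mem_zpowers x⟩, 1, fun h => hne (congrArg Subtype.val h)⟩⟩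
    rw [hG]
    exact Finite.one_lt_card
  obtain ⟨g, x, hx, hxg⟩ := key G hG
  obtain ⟨k, y, hy, hyk⟩ := key K hK
  have e1 := key2 _ ((card_conjBy g G).trans hG) x hx hxg
  have e2 := key2 _ ((card_conjBy k K).trans hK) y hy hyk
  have hxy : x = y := Subtype.ext (hxg.trans hyk.symm)
  refine ⟨k⁻¹ * g, ?_⟩
  rw [← conjBy_conjBy, e1, hxy, ← e2, conjBy_inv_conjBy]

/-- Subgroups of the icosahedral group of the same order are conjugate. -/
theorem exists_conjBy_eq_of_card_eq {G K : Subgroup icosahedralGroup}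
    (h : Nat.card G = Nat.card K) (hG : Nat.card G ∈ [1, 2, 3, 4, 5, 6, 10, 12]) :
    ∃ g, conjBy g G = K := by
  have : Fact (Nat.Prime 5) := ⟨Nat.prime_five⟩
  have symm : ∀ {P : Subgroup icosahedralGroup}, (∃ g, conjBy g G = P) → (∃ g, conjBy g K = P) →
      ∃ g, conjBy g G = K := by
    rintro P ⟨g, hg⟩ ⟨k, rfl⟩
    refine ⟨k⁻¹ * g, ?_⟩
    rw [← conjBy_conjBy, hg, conjBy_inv_conjBy]
  -- Orders 6, 10, 12: such a group is conjugate into the normalizer of a Sylow subgroup, and equal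
  -- to it by order.
  have normal : ∀ {p k : ℕ} [Fact p.Prime] {P : Subgroup icosahedralGroup}
      (_ : (Nat.card icosahedralGroup).factorization p = k) (_ : Nat.card P = p ^ k)
      (_ : ∀ x, conjBy x P ⊓ P = ⊥ ∨ x ∈ Subgroup.normalizer (P : Set icosahedralGroup))
      {n : ℕ} (_ : Nat.card (Subgroup.normalizer (P : Set icosahedralGroup)) = n)
      (_ : p ^ k ∣ n) (_ : n < (p ^ k) ^ 2) (_ : Nat.card G = n), ∃ g, conjBy g G = K := by
    intro p k _ P hk hP hTI n hn hdvd hlt hGn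
    have aux : ∀ H : Subgroup icosahedralGroup, Nat.card H = n →
        ∃ g, conjBy g H = Subgroup.normalizer (P : Set icosahedralGroup) := by
      intro H hH
      subst hH
      obtain ⟨g, hg⟩ := exists_conjBy_le_normalizer hk hP hTI hdvd hlt
      exact ⟨g, Subgroup.eq_of_le_of_card_ge hg (by rw [card_conjBy, hn])⟩
    exact symm (aux G hGn) (aux K (h ▸ hGn))
  -- Orders 3, 4, 5: full Sylow subgroups.
  have sylow : ∀ {p k : ℕ} [Fact p.Prime] {P : Subgroup icosahedralGroup}
      (_ : (Nat.card icosahedralGroup).factorization p = k) (_ : Nat.card P = p ^ k)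
      (_ : Nat.card G = p ^ k), ∃ g, conjBy g G = K := by
    intro p k _ P hk hP hGn
    have aux : ∀ H : Subgroup icosahedralGroup, Nat.card H = p ^ k → ∃ g, conjBy g H = P :=
      fun H hH => exists_conjBy_eq (exists_le_conjBy hk hP hH.symm.dvd) (hH.trans hP.symm).le
    exact symm (aux G hGn) (aux K (h ▸ hGn))
  simp only [List.mem_cons, List.not_mem_nil, or_false] at hG
  rcases hG with hG | hG | hG | hG | hG | hG | hG | hG
  · refine ⟨1, ?_⟩
    rw [conjBy_one, Subgroup.card_eq_one.1 hG, Subgroup.card_eq_one.1 (h.symm.trans hG)]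
  · exact exists_conjBy_eq_of_card_two hG (h ▸ hG)
  · exact sylow factorization_three card_sylowThree hG
  · exact sylow factorization_two card_sylowTwo hG
  · exact sylow factorization_five card_sylowFive hG
  · exact normal factorization_three card_sylowThree conjBy_inf_sylowThree
      card_normalizer_sylowThree (by norm_num) (by norm_num) hG
  · exact normal factorization_five card_sylowFive conjBy_inf_sylowFive
      card_normalizer_sylowFive (by norm_num) (by norm_num) hG
  · exact normal factorization_two card_sylowTwo conjBy_inf_sylowTwo
      card_normalizer_sylowTwo (by norm_num) (by norm_num) hG

/-! ### Intersections in the class of the icosahedral group -/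

theorem card_subgroupRep (G : Subgroup icosahedralGroup) : Nat.card (subgroupRep G) = Nat.card G :=
  Subgroup.card_map_of_injective icosahedralRep_injective

/-- The class of an intersection is determined by its order. -/
theorem inf_mem_conjClass_iff {G : Subgroup icosahedralGroup}
    (hG : Nat.card G ∈ [1, 2, 3, 4, 5, 6, 10, 12]) {H K : Subgroup B6} (hH : H ∈ crystClass) :
    H ⊓ K ∈ conjClass (subgroupRep G) ↔ Nat.card (H ⊓ K : Subgroup B6) = Nat.card G := by
  constructor
  · rintro ⟨g, hg⟩
    rw [hg, ← card_subgroupRep G]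
    exact card_conjBy g _
  · intro h
    obtain ⟨g, rfl⟩ := hH
    -- Conjugated back, the intersection is the image of an icosahedral subgroup `M`, to which the
    -- conjugacy theorem applies.
    have hle : conjBy g⁻¹ (conjBy g hatI ⊓ K) ≤ hatI := by
      rw [conjBy_inf, conjBy_inv_conjBy]
      exact inf_le_left
    obtain ⟨M, hM⟩ : ∃ M : Subgroup icosahedralGroup,
        subgroupRep M = conjBy g⁻¹ (conjBy g hatI ⊓ K) :=
      ⟨_, Subgroup.map_comap_eq_self hle⟩
    have hcard : Nat.card G = Nat.card M := by
      rw [← card_subgroupRep M, hM, card_conjBy, h]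
    obtain ⟨x, hx⟩ := exists_conjBy_eq_of_card_eq hcard hG
    refine ⟨g * icosahedralRep x, ?_⟩
    change conjBy g hatI ⊓ K = conjBy (g * icosahedralRep x) (subgroupRep G)
    have hxM : subgroupRep M = conjBy (icosahedralRep x) (subgroupRep G) := by
      rw [← hx]
      unfold subgroupRep
      ext y
      constructor
      · rintro ⟨_, ⟨z, hz, rfl⟩, rfl⟩
        exact ⟨_, ⟨z, hz, rfl⟩, by simp⟩
      · rintro ⟨_, ⟨z, hz, rfl⟩, rfl⟩
        exact ⟨_, ⟨z, hz, rfl⟩, by simp⟩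
    rw [← conjBy_conjBy, ← hxM, hM]
    simpa using (conjBy_inv_conjBy g⁻¹ (conjBy g hatI ⊓ K)).symm

theorem ncard_crystClass_inf_mem {G : Subgroup icosahedralGroup}
    (hG : Nat.card G ∈ [1, 2, 3, 4, 5, 6, 10, 12]) {H : Subgroup B6} (hH : H ∈ crystClass) :
    {K | K ∈ crystClass ∧ H ⊓ K ∈ conjClass (subgroupRep G)}.ncard =
      interCounts.count (Nat.card G) := by
  rw [← ncard_crystClass_card_inf hH]
  simp only [inf_mem_conjClass_iff hG hH]

theorem card_of_mem_crystClass {H : Subgroup B6} (hH : H ∈ crystClass) : Nat.card H = 60 := by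
  obtain ⟨g, rfl⟩ := hH
  rw [← card_icosahedralGroup]
  exact (card_conjBy g _).trans
    (Nat.card_congr (MonoidHom.ofInjective icosahedralRep_injective).toEquiv).symm

theorem isRegularOfDegree_subgroupGraph {G : Subgroup icosahedralGroup}
    (hG : Nat.card G ∈ [1, 2, 3, 4, 5, 6, 10, 12]) :
    (subgroupGraph G).IsRegularOfDegree (interCounts.count (Nat.card G)) := by
  intro H
  rw [degree_subgroupGraph, ← ncard_crystClass_inf_mem hG H.2]
  congr 1
  ext K
  refine and_congr_right fun hK => ?_
  constructor
  · rintro ⟨-, P, hP, rfl⟩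
    exact hP
  · intro h
    refine ⟨?_, _, h, rfl⟩
    -- A loop would need the order 60, which is not in the list; so requiring distinct vertices does
    -- not change the count.
    rintro rfl
    rw [inf_mem_conjClass_iff hG H.2, inf_idem, card_of_mem_crystClass H.2] at h
    rw [← h] at hG
    exact absurd hG (by decide)

theorem finite_crystClass : crystClass.Finite := by
  refine Set.finite_of_encard_eq_coe (k := 192) ?_
  rw [crystClass_encard]
  rfl

theorem encard_crystClass_inf {G : Subgroup icosahedralGroup}
    (hG : Nat.card G ∈ [1, 2, 3, 4, 5, 6, 10, 12]) {H : Subgroup B6} (hH : H ∈ crystClass) :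
    {K ∈ crystClass | ∃ P ∈ conjClass (subgroupRep G), H ⊓ K = P}.encard =
      (interCounts.count (Nat.card G) : ℕ) := by
  have h : {K ∈ crystClass | ∃ P ∈ conjClass (subgroupRep G), H ⊓ K = P} =
      {K | K ∈ crystClass ∧ H ⊓ K ∈ conjClass (subgroupRep G)} := by
    ext K
    simp
  rw [h, ← ncard_crystClass_inf_mem hG hH, Set.Finite.cast_ncard_eq]
  exact finite_crystClass.subset fun K hK => hK.1

/-- The order of a subgroup of one of the eight types, and the degree of its graph. -/
theorem card_and_count_of_type {G : Subgroup icosahedralGroup} {d : ℕ}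
    (h : (Nonempty (G ≃* alternatingGroup (Fin 4)) ∧ d = 5) ∨
      (Nonempty (G ≃* DihedralGroup 5) ∧ d = 6) ∨
      (Nonempty (G ≃* DihedralGroup 3) ∧ d = 10) ∨
      (Nonempty (G ≃* Multiplicative (ZMod 5)) ∧ d = 0) ∨
      (Nonempty (G ≃* DihedralGroup 2) ∧ d = 30) ∨
      (Nonempty (G ≃* Multiplicative (ZMod 3)) ∧ d = 20) ∨
      (Nonempty (G ≃* Multiplicative (ZMod 2)) ∧ d = 60) ∨
      (G = ⊥ ∧ d = 60)) :
    Nat.card G ∈ [1, 2, 3, 4, 5, 6, 10, 12] ∧ interCounts.count (Nat.card G) = d := by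
  have hcount : interCounts.count 12 = 5 ∧ interCounts.count 10 = 6 ∧ interCounts.count 6 = 10 ∧
      interCounts.count 5 = 0 ∧ interCounts.count 4 = 30 ∧ interCounts.count 3 = 20 ∧
      interCounts.count 2 = 60 ∧ interCounts.count 1 = 60 := by decide +kernel
  obtain ⟨c12, c10, c6, c5, c4, c3, c2, c1⟩ := hcount
  have hA4 : Nat.card (alternatingGroup (Fin 4)) = 12 := by
    rw [nat_card_alternatingGroup]
    simp [Nat.factorial]
  rcases h with ⟨⟨e⟩, rfl⟩ | ⟨⟨e⟩, rfl⟩ | ⟨⟨e⟩, rfl⟩ | ⟨⟨e⟩, rfl⟩ | ⟨⟨e⟩, rfl⟩ | ⟨⟨e⟩, rfl⟩ |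
    ⟨⟨e⟩, rfl⟩ | ⟨rfl, rfl⟩
  · rw [Nat.card_congr e.toEquiv, hA4, c12]; simp
  · rw [Nat.card_congr e.toEquiv, DihedralGroup.nat_card, c10]; simp
  · rw [Nat.card_congr e.toEquiv, DihedralGroup.nat_card, c6]; simp
  · rw [Nat.card_congr e.toEquiv, Nat.card_congr Multiplicative.toAdd, Nat.card_zmod, c5]; simp
  · rw [Nat.card_congr e.toEquiv, DihedralGroup.nat_card, c4]; simp
  · rw [Nat.card_congr e.toEquiv, Nat.card_congr Multiplicative.toAdd, Nat.card_zmod, c3]; simp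
  · rw [Nat.card_congr e.toEquiv, Nat.card_congr Multiplicative.toAdd, Nat.card_zmod, c2]; simp
  · rw [Subgroup.card_bot, c1]; simp

/-! ### Members of the class of the icosahedral group are crystallographic -/

/-- The natural representation of `B₆` on `ℝ⁶`. -/
noncomputable def stdRep : Representation ℝ B6 (Fin 6 → ℝ) where
  toFun A := Matrix.toLin' (A.1.map (Int.cast : ℤ → ℝ))
  map_one' := by
    simp
    rfl
  map_mul' A B := by
    change Matrix.toLin' ((A.1 * B.1).map (Int.cast : ℤ → ℝ)) = _
    rw [Matrix.map_mul_intCast, Matrix.toLin'_mul]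
    rfl

theorem stdRep_apply (A : B6) (v : Fin 6 → ℝ) (i : Fin 6) :
    stdRep A v i = ∑ j, (A.1 i j : ℝ) * v j := rfl

theorem stdRep_apply_inv (A : B6) (v : Fin 6 → ℝ) : stdRep A (stdRep A⁻¹ v) = v := by
  rw [← Module.End.mul_apply, ← map_mul, mul_inv_cancel, map_one]
  rfl

/-- The vector `± e_i` that belongs to the vertex `k`. -/
def vertexVec (k : Fin 12) : Fin 6 → ℝ := fun i => (coord i k : ℝ)

theorem stdRep_vertexVec (p : signedPerms) (k : Fin 12) :
    stdRep (signedRep p) (vertexVec k) = vertexVec (p.1 k) := by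
  ext i
  rw [stdRep_apply, vertexVec, coord_eq p.1 p.2]
  push_cast
  rfl

theorem vertexVec_vtx (j : Fin 6) : vertexVec (vtx j) = Pi.single j 1 := by
  ext i
  simp [vertexVec, coord_vtx, Pi.single_apply]

theorem vertexVec_add_six (k : Fin 12) : vertexVec (k + 6) = -vertexVec k := by
  ext i
  simp [vertexVec, coord_add_six]

/-- The matrix of signed adjacencies of the axes of the icosahedron. -/
def adjMatrix : Matrix (Fin 6) (Fin 6) ℤ :=
  !![0, 1, -1, -1, 1, 1; 1, 0, 1, -1, -1, 1; -1, 1, 0, 1, -1, 1; -1, -1, 1, 0, 1, 1;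
    1, -1, -1, 1, 0, 1; 1, 1, 1, 1, 1, 0]

/-- The six axes are equiangular, with cosines ±1/√5, and `adjMatrix` records the signs: a symmetric
conference matrix of order 6. -/
theorem adjMatrix_mul_self : adjMatrix * adjMatrix = Matrix.diagonal fun _ => 5 := by
  decide +kernel

theorem adjMatrix_comm {p : Perm (Fin 12)} (hp : p ∈ icosahedralGroup) :
    adjMatrix * signedMatrix p = signedMatrix p * adjMatrix := by
  induction hp using Subgroup.closure_induction with
  | mem x hx => rcases hx with rfl | rfl <;> decide +kernel
  | one => rw [signedMatrix_one, one_mul, mul_one]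
  | mul x y hx _ h1 h2 =>
    rw [signedMatrix_mul _ _ (icosahedralGroup_le hx), ← mul_assoc, h1, mul_assoc, h2, mul_assoc]
  | inv x hx h1 =>
    have hx' := icosahedralGroup_le hx
    have e1 : signedMatrix x⁻¹ * signedMatrix x = 1 := by
      rw [← signedMatrix_mul _ _ (inv_mem hx'), inv_mul_cancel, signedMatrix_one]
    have e2 : signedMatrix x * signedMatrix x⁻¹ = 1 := by
      rw [← signedMatrix_mul _ _ hx', mul_inv_cancel, signedMatrix_one]
    calc adjMatrix * signedMatrix x⁻¹
        = signedMatrix x⁻¹ * (signedMatrix x * adjMatrix) * signedMatrix x⁻¹ := by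
          rw [← mul_assoc, e1, one_mul]
      _ = signedMatrix x⁻¹ * adjMatrix := by
          rw [← h1, mul_assoc, mul_assoc, e2, mul_one]

/-- The linear map of `adjMatrix`. -/
noncomputable def adjMap : Module.End ℝ (Fin 6 → ℝ) :=
  Matrix.toLin' (adjMatrix.map (Int.cast : ℤ → ℝ))

theorem adjMap_mul_self : adjMap * adjMap = (5 : ℝ) • (1 : Module.End ℝ (Fin 6 → ℝ)) := by
  have h : adjMap * adjMap = Matrix.toLin' ((adjMatrix * adjMatrix).map (Int.cast : ℤ → ℝ)) := by
    rw [Matrix.map_mul_intCast, Matrix.toLin'_mul]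
    rfl
  rw [h, adjMatrix_mul_self]
  refine LinearMap.ext fun v => ?_
  ext i
  simp [Matrix.toLin'_apply, Matrix.diagonal_map, Matrix.mulVec_diagonal]

theorem adjMap_comm {A : B6} (hA : A ∈ hatI) : adjMap * stdRep A = stdRep A * adjMap := by
  obtain ⟨p, rfl⟩ := hA
  have h : (adjMatrix * signedMatrix p.1).map (Int.cast : ℤ → ℝ) =
      (signedMatrix p.1 * adjMatrix).map (Int.cast : ℤ → ℝ) := by
    rw [adjMatrix_comm p.2]
  rw [Matrix.map_mul_intCast, Matrix.map_mul_intCast] at h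
  have h' := congrArg Matrix.toLin' h
  rw [Matrix.toLin'_mul, Matrix.toLin'_mul] at h'
  exact h'

theorem trace_adjMap : LinearMap.trace ℝ _ adjMap = 0 := by
  rw [adjMap, Matrix.trace_toLin'_eq]
  simp [Matrix.trace, Fin.sum_univ_succ, adjMatrix]

/-- The vectors fixed by the five-fold rotation about the axis of the vertex `0`. -/
theorem eq_of_stdRep_rotation_eq {v : Fin 6 → ℝ}
    (hv : ∀ p : signedPerms, p.1 = g3 * g2 → stdRep (signedRep p) v = v) :
    v = v 0 • vertexVec 0 + v 1 • adjMap (vertexVec 0) := by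
  have hmem : g3 * g2 ∈ signedPerms := icosahedralGroup_le
    (mul_mem (Subgroup.subset_closure (by simp)) (Subgroup.subset_closure (by simp)))
  have hM : signedMatrix (g3 * g2) = !![1, 0, 0, 0, 0, 0; 0, 0, 0, -1, 0, 0; 0, 0, 0, 0, -1, 0;
      0, 0, 1, 0, 0, 0; 0, 0, 0, 0, 0, 1; 0, 1, 0, 0, 0, 0] := by decide +kernel
  have h := hv ⟨g3 * g2, hmem⟩ rfl
  have hi : ∀ i, ∑ j, (signedMatrix (g3 * g2) i j : ℝ) * v j = v i := fun i => congrFun h i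
  rw [hM] at hi
  have h1 := hi 1
  have h2 := hi 2
  have h3 := hi 3
  have h4 := hi 4
  have h5 := hi 5
  simp [Fin.sum_univ_succ] at h1 h2 h3 h4 h5
  have hadj : ∀ i, adjMap (vertexVec 0) i = (adjMatrix i 0 : ℝ) := by
    intro i
    rw [show (0 : Fin 12) = vtx 0 from rfl, vertexVec_vtx, adjMap, Matrix.toLin'_apply,
      Matrix.mulVec_single_one]
    rfl
  -- The rotation equations leave v = (v₀, v₁, -v₁, -v₁, v₁, v₁), and the signs are those of the
  -- first column of `adjMatrix`.
  ext i
  rw [Pi.add_apply, Pi.smul_apply, Pi.smul_apply, hadj]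
  fin_cases i <;> simp [vertexVec, coord, vtx, adjMatrix] <;> linarith

/-- The commutant of the icosahedral group is spanned by `1` and `adjMap`. -/
theorem exists_eq_smul_add_smul {M : Module.End ℝ (Fin 6 → ℝ)}
    (hM : ∀ A ∈ hatI, M * stdRep A = stdRep A * M) :
    ∃ a b : ℝ, M = a • (1 : Module.End ℝ (Fin 6 → ℝ)) + b • adjMap := by
  have hM' : ∀ A ∈ hatI, ∀ v, M (stdRep A v) = stdRep A (M v) :=
    fun A hA v => LinearMap.congr_fun (hM A hA) v
  have hT' : ∀ A ∈ hatI, ∀ v, adjMap (stdRep A v) = stdRep A (adjMap v) :=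
    fun A hA v => LinearMap.congr_fun (adjMap_comm hA) v
  -- `M` sends a vector fixed by the five-fold rotation to a fixed vector. Two numbers thus
  -- determine its value at vertex 0, and transitivity of the rotations determines the rest.
  have h0 := eq_of_stdRep_rotation_eq (v := M (vertexVec 0)) (by
    rintro p hp
    have hpI : p.1 ∈ icosahedralGroup := by
      rw [hp]
      exact mul_mem (Subgroup.subset_closure (by simp)) (Subgroup.subset_closure (by simp))
    rw [← hM' _ (signedRep_mem_hatI.2 hpI), stdRep_vertexVec, hp,
      show (g3 * g2) 0 = 0 by decide +kernel])
  generalize M (vertexVec 0) 0 = a at h0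
  generalize M (vertexVec 0) 1 = b at h0
  refine ⟨a, b, LinearMap.pi_ext' fun j => LinearMap.ext_ring ?_⟩
  rw [LinearMap.comp_apply, LinearMap.comp_apply, LinearMap.coe_single, ← vertexVec_vtx]
  obtain ⟨a', ha'⟩ : ∃ a' : Fin 12, ¬ SameAxis (vtx j) a' :=
    ⟨vtx j + 1, (by decide : ∀ j, ¬ SameAxis (vtx j) (vtx j + 1)) j⟩
  obtain ⟨g, hg, hgj, -⟩ := exists_rotation (vtx j) a' ha'
  have hv : vertexVec (vtx j) =
      stdRep (signedRep ⟨g, icosahedralGroup_le hg⟩) (vertexVec 0) := by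
    rw [stdRep_vertexVec, hgj]
  have hA : signedRep ⟨g, icosahedralGroup_le hg⟩ ∈ hatI := signedRep_mem_hatI.2 hg
  rw [hv, hM' _ hA, h0]
  simp only [map_add, map_smul, LinearMap.add_apply, LinearMap.smul_apply, Module.End.one_apply,
    hT' _ hA]

/-! ### The eigenspaces: dimension, irreducibility and inequivalence -/

/-- The conjugate of `adjMap` that commutes with the conjugate of the icosahedral group by `g`. -/
noncomputable def adjMapConj (g : B6) : Module.End ℝ (Fin 6 → ℝ) := stdRep g * adjMap * stdRep g⁻¹

theorem stdRep_mul_inv (g : B6) : stdRep g * stdRep g⁻¹ = 1 := by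
  rw [← map_mul, mul_inv_cancel, map_one]

theorem stdRep_inv_mul (g : B6) : stdRep g⁻¹ * stdRep g = 1 := by
  rw [← map_mul, inv_mul_cancel, map_one]

theorem adjMapConj_mul_self (g : B6) :
    adjMapConj g * adjMapConj g = (5 : ℝ) • (1 : Module.End ℝ (Fin 6 → ℝ)) := by
  calc adjMapConj g * adjMapConj g
      = stdRep g * adjMap * (stdRep g⁻¹ * stdRep g) * adjMap * stdRep g⁻¹ := by
        simp only [adjMapConj, mul_assoc]
    _ = stdRep g * (adjMap * adjMap) * stdRep g⁻¹ := by
        rw [stdRep_inv_mul, mul_one, mul_assoc (stdRep g)]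
    _ = _ := by
        rw [adjMap_mul_self, mul_smul_comm, smul_mul_assoc, mul_one, stdRep_mul_inv]

theorem trace_adjMapConj (g : B6) : LinearMap.trace ℝ _ (adjMapConj g) = 0 := by
  rw [adjMapConj, LinearMap.trace_mul_comm, ← mul_assoc, stdRep_inv_mul, one_mul, trace_adjMap]

theorem adjMapConj_comm {g A : B6} (hA : A ∈ conjBy g hatI) :
    adjMapConj g * stdRep A = stdRep A * adjMapConj g := by
  obtain ⟨B, hB, rfl⟩ := hA
  change adjMapConj g * stdRep (g * B * g⁻¹) = stdRep (g * B * g⁻¹) * adjMapConj g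
  simp only [adjMapConj, map_mul]
  calc stdRep g * adjMap * stdRep g⁻¹ * (stdRep g * stdRep B * stdRep g⁻¹)
      = stdRep g * adjMap * (stdRep g⁻¹ * stdRep g) * stdRep B * stdRep g⁻¹ := by
        simp only [mul_assoc]
    _ = stdRep g * (adjMap * stdRep B) * stdRep g⁻¹ := by
        rw [stdRep_inv_mul, mul_one, mul_assoc (stdRep g)]
    _ = stdRep g * stdRep B * (stdRep g⁻¹ * stdRep g) * adjMap * stdRep g⁻¹ := by
        rw [adjMap_comm hB, stdRep_inv_mul, mul_one]; simp only [mul_assoc]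
    _ = _ := by simp only [mul_assoc]

theorem exists_eq_smul_add_smul_conj {g : B6} {M : Module.End ℝ (Fin 6 → ℝ)}
    (hM : ∀ A ∈ conjBy g hatI, M * stdRep A = stdRep A * M) :
    ∃ a b : ℝ, M = a • (1 : Module.End ℝ (Fin 6 → ℝ)) + b • adjMapConj g := by
  obtain ⟨a, b, h⟩ := exists_eq_smul_add_smul (M := stdRep g⁻¹ * M * stdRep g) (by
    intro A hA
    have h := hM (g * A * g⁻¹) ⟨A, hA, rfl⟩
    rw [map_mul, map_mul] at h
    calc stdRep g⁻¹ * M * stdRep g * stdRep A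
        = stdRep g⁻¹ * (M * (stdRep g * stdRep A * stdRep g⁻¹)) * stdRep g := by
          simp only [mul_assoc, stdRep_inv_mul, mul_one]
      _ = (stdRep g⁻¹ * stdRep g) * stdRep A * stdRep g⁻¹ * M * stdRep g := by
          rw [h]; simp only [mul_assoc]
      _ = _ := by rw [stdRep_inv_mul, one_mul]; simp only [mul_assoc])
  refine ⟨a, b, ?_⟩
  calc M = (stdRep g * stdRep g⁻¹) * M * (stdRep g * stdRep g⁻¹) := by
        rw [stdRep_mul_inv, one_mul, mul_one]
    _ = stdRep g * (stdRep g⁻¹ * M * stdRep g) * stdRep g⁻¹ := by simp only [mul_assoc]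
    _ = _ := by
        rw [h, mul_add, add_mul, mul_smul_comm, smul_mul_assoc, mul_one, stdRep_mul_inv,
          mul_smul_comm, smul_mul_assoc, adjMapConj]

/-- The eigenspaces of `adjMapConj g`. -/
noncomputable def eigSpace (g : B6) (s : ℝ) : Submodule ℝ (Fin 6 → ℝ) :=
  (adjMapConj g).eigenspace s

theorem mem_eigSpace {g : B6} {s : ℝ} {v : Fin 6 → ℝ} :
    v ∈ eigSpace g s ↔ adjMapConj g v = s • v := Module.End.mem_eigenspace_iff

theorem adjMapConj_apply_apply (g : B6) (v : Fin 6 → ℝ) :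
    adjMapConj g (adjMapConj g v) = (5 : ℝ) • v :=
  LinearMap.congr_fun (adjMapConj_mul_self g) v

theorem adjMapConj_add_mem {g : B6} {s : ℝ} (hs : s * s = 5) (v : Fin 6 → ℝ) :
    adjMapConj g v + s • v ∈ eigSpace g s := by
  rw [mem_eigSpace, map_add, map_smul, adjMapConj_apply_apply, smul_add, smul_smul, hs, add_comm]

/-- With T = `adjMapConj g`, the map (T + s)/(2s) is a projection onto the eigenspace. Since T has
trace 0, the trace of the projection is 6s/(2s) = 3. -/
theorem finrank_eigSpace {g : B6} {s : ℝ} (hs : s * s = 5) :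
    Module.finrank ℝ (eigSpace g s) = 3 := by
  have hs0 : s ≠ 0 := by rintro rfl; norm_num at hs
  have hproj : LinearMap.IsProj (eigSpace g s)
      ((2 * s)⁻¹ • (adjMapConj g + s • (1 : Module.End ℝ (Fin 6 → ℝ)))) := by
    constructor
    · intro v
      exact Submodule.smul_mem _ _ (adjMapConj_add_mem hs v)
    · intro v hv
      change (2 * s)⁻¹ • (adjMapConj g v + s • v) = v
      rw [mem_eigSpace.1 hv, ← two_smul ℝ, smul_smul 2 s, smul_smul,
        inv_mul_cancel₀ (mul_ne_zero two_ne_zero hs0), one_smul]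
  have h := hproj.trace
  rw [map_smul, map_add, trace_adjMapConj, map_smul, LinearMap.trace_one] at h
  simp only [Module.finrank_fintype_fun_eq_card, Fintype.card_fin, smul_eq_mul, zero_add] at h
  have : (Module.finrank ℝ (eigSpace g s) : ℝ) = (3 : ℕ) := by
    rw [← h]
    push_cast
    field_simp
    norm_num
  exact_mod_cast this

theorem isCompl_eigSpace {g : B6} {s : ℝ} (hs : s * s = 5) :
    IsCompl (eigSpace g s) (eigSpace g (-s)) := by
  have hs0 : s ≠ 0 := by rintro rfl; norm_num at hs
  have hs' : -s * -s = 5 := by rw [neg_mul_neg, hs]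
  constructor
  · rw [Submodule.disjoint_def]
    intro v h1 h2
    rw [mem_eigSpace] at h1 h2
    rw [h1, neg_smul, eq_neg_iff_add_eq_zero, ← two_smul ℝ, smul_smul, smul_eq_zero] at h2
    exact h2.resolve_left (by simpa using hs0)
  · rw [codisjoint_iff, eq_top_iff]
    intro v _
    rw [Submodule.mem_sup]
    refine ⟨_, Submodule.smul_mem _ (2 * s)⁻¹ (adjMapConj_add_mem hs v), _,
      Submodule.smul_mem _ (-(2 * s)⁻¹) (adjMapConj_add_mem hs' v), ?_⟩
    have h : (2 * s)⁻¹ * s + (2 * s)⁻¹ * s = 1 := by field_simp; norm_num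
    rw [neg_smul, smul_add, smul_add, neg_smul, smul_neg, smul_smul]
    rw [show ∀ x y : Fin 6 → ℝ, x + y + -(x + -y) = y + y by intro x y; abel, ← add_smul, h,
      one_smul]

theorem stdRep_mem_eigSpace {g A : B6} (hA : A ∈ conjBy g hatI) {s : ℝ} {v : Fin 6 → ℝ}
    (hv : v ∈ eigSpace g s) : stdRep A v ∈ eigSpace g s := by
  rw [mem_eigSpace] at hv ⊢
  have h : adjMapConj g (stdRep A v) = stdRep A (adjMapConj g v) :=
    LinearMap.congr_fun (adjMapConj_comm hA) v
  rw [h, hv, map_smul]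

/-- An eigenspace of `adjMapConj g`, as a subrepresentation. -/
noncomputable def eigRep (g : B6) (s : ℝ) : Subrepresentation (natRep (conjBy g hatI)) where
  toSubmodule := eigSpace g s
  apply_mem_toSubmodule A _ hv := stdRep_mem_eigSpace A.2 hv

/-- Averaging a projection onto `U` over the group gives a map `M` into `U` that lies in the
commutant, so it is a scalar on the eigenspace. On `U` that scalar is the group order, which is
nonzero; hence the whole eigenspace lies in the range of `M`. -/
theorem eigSpace_le_of_invariant {g : B6} {s : ℝ} {U : Submodule ℝ (Fin 6 → ℝ)}
    (hU : ∀ A ∈ conjBy g hatI, ∀ v ∈ U, stdRep A v ∈ U) (hle : U ≤ eigSpace g s) (hne : U ≠ ⊥) :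
    eigSpace g s ≤ U := by
  obtain ⟨W, hW⟩ := U.exists_isCompl
  let P : Module.End ℝ (Fin 6 → ℝ) := U.subtype ∘ₗ U.projectionOnto W hW
  have hP : ∀ v, P v ∈ U := fun v => (U.projectionOnto W hW v).2
  have hPU : ∀ u ∈ U, P u = u := fun u hu =>
    congrArg Subtype.val (Submodule.projectionOnto_apply_left hW ⟨u, hu⟩)
  let K := conjBy g hatI
  have : Fintype K := Fintype.ofFinite K
  let M : Module.End ℝ (Fin 6 → ℝ) := ∑ k : K, stdRep k.1 * P * stdRep k.1⁻¹
  have hMapply : ∀ v, M v = ∑ k : K, stdRep k.1 (P (stdRep k.1⁻¹ v)) := by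
    intro v
    simp only [M, LinearMap.sum_apply]
    rfl
  have hM : ∀ A ∈ conjBy g hatI, M * stdRep A = stdRep A * M := by
    intro A hA
    simp only [M, Finset.sum_mul, Finset.mul_sum]
    rw [← Equiv.sum_comp (Equiv.mulLeft (⟨A, hA⟩ : K))]
    refine Finset.sum_congr rfl fun k _ => ?_
    change stdRep (A * k.1) * P * stdRep (A * k.1)⁻¹ * stdRep A = _
    rw [mul_assoc, ← map_mul, mul_inv_rev, inv_mul_cancel_right, map_mul]
    simp only [mul_assoc]
  have hMU : ∀ v, M v ∈ U := by
    intro v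
    rw [hMapply]
    exact Submodule.sum_mem _ fun k _ => hU _ k.2 _ (hP _)
  have hMu : ∀ u ∈ U, M u = (Fintype.card K : ℝ) • u := by
    intro u hu
    rw [hMapply, Finset.sum_congr rfl fun k _ => by
      rw [hPU _ (hU _ (inv_mem k.2) u hu), stdRep_apply_inv]]
    rw [Finset.sum_const, Finset.card_univ, Nat.cast_smul_eq_nsmul]
  obtain ⟨a, b, hab⟩ := exists_eq_smul_add_smul_conj hM
  have hMs : ∀ v ∈ eigSpace g s, M v = (a + b * s) • v := by
    intro v hv
    rw [hab, LinearMap.add_apply, LinearMap.smul_apply, LinearMap.smul_apply, mem_eigSpace.1 hv,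
      Module.End.one_apply, smul_smul, ← add_smul]
  obtain ⟨u, hu, hu0⟩ := Submodule.exists_mem_ne_zero_of_ne_bot hne
  have hc : a + b * s = Fintype.card K := by
    have h := (hMs u (hle hu)).symm.trans (hMu u hu)
    rw [← sub_eq_zero, ← sub_smul, smul_eq_zero] at h
    exact sub_eq_zero.1 (h.resolve_right hu0)
  have hc0 : a + b * s ≠ 0 := by
    rw [hc]
    exact_mod_cast Fintype.card_ne_zero
  intro v hv
  have h := hMU v
  rw [hMs v hv] at h
  exact (Submodule.smul_mem_iff _ hc0).1 h

theorem isIrreducible_eigRep {g : B6} {s : ℝ} (hs : s * s = 5) :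
    (eigRep g s).toRepresentation.IsIrreducible := by
  have hnt : Nontrivial (Subrepresentation (eigRep g s).toRepresentation) := by
    refine ⟨⊥, ⊤, fun h => ?_⟩
    have h1 : (⊥ : Submodule ℝ (eigSpace g s)) = ⊤ := congrArg Subrepresentation.toSubmodule h
    have h2 := finrank_top ℝ (eigSpace g s)
    rw [← h1, finrank_bot, finrank_eigSpace hs] at h2
    norm_num at h2
  refine { eq_bot_or_eq_top := fun U => ?_ }
  let U' : Submodule ℝ (Fin 6 → ℝ) := U.toSubmodule.map (eigSpace g s).subtype
  by_cases hU : U' = ⊥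
  · left
    refine Subrepresentation.toSubmodule_injective ?_
    exact (Submodule.map_injective_of_injective (Submodule.subtype_injective _))
      (hU.trans (Submodule.map_bot _).symm)
  · right
    have hinv : ∀ A ∈ conjBy g hatI, ∀ v ∈ U', stdRep A v ∈ U' := by
      rintro A hA _ ⟨u, hu, rfl⟩
      exact ⟨_, U.apply_mem_toSubmodule ⟨A, hA⟩ hu, rfl⟩
    have hle := eigSpace_le_of_invariant hinv (Submodule.map_subtype_le _ _) hU
    refine Subrepresentation.toSubmodule_injective (eq_top_iff.2 fun v _ => ?_)
    obtain ⟨u, hu, huv⟩ := hle v.2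
    have : u = v := Subtype.ext huv
    exact this ▸ hu

/-- An equivalence, preceded by a multiple of the projection onto the first eigenspace, lies in the
commutant. It therefore preserves that eigenspace while mapping into the other one, so it vanishes
there, against injectivity. -/
theorem isEmpty_equiv_eigRep {g : B6} {s : ℝ} (hs : s * s = 5) :
    IsEmpty (Representation.Equiv (eigRep g s).toRepresentation
      (eigRep g (-s)).toRepresentation) := by
  refine ⟨fun φ => ?_⟩
  have hs0 : s ≠ 0 := by rintro rfl; norm_num at hs
  let π : (Fin 6 → ℝ) →ₗ[ℝ] eigSpace g s :=
    (adjMapConj g + s • (1 : Module.End ℝ (Fin 6 → ℝ))).codRestrict (eigSpace g s)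
      (adjMapConj_add_mem hs)
  let f : eigSpace g s →ₗ[ℝ] eigSpace g (-s) := φ.toIntertwiningMap.toLinearMap
  have hf : Function.Injective f := φ.toLinearEquiv.injective
  have hfcomm : ∀ A (hA : A ∈ conjBy g hatI) (v : eigSpace g s),
      (f ⟨stdRep A v, stdRep_mem_eigSpace hA v.2⟩ : Fin 6 → ℝ) = stdRep A (f v) := fun A hA v =>
    congrArg Subtype.val (LinearMap.congr_fun (φ.toIntertwiningMap.isIntertwining' ⟨A, hA⟩) v)
  let M : Module.End ℝ (Fin 6 → ℝ) := (eigSpace g (-s)).subtype ∘ₗ f ∘ₗ π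
  have hM : ∀ A ∈ conjBy g hatI, M * stdRep A = stdRep A * M := by
    intro A hA
    refine LinearMap.ext fun v => ?_
    have hπ : π (stdRep A v) = ⟨stdRep A (π v), stdRep_mem_eigSpace hA (π v).2⟩ := by
      refine Subtype.ext ?_
      change adjMapConj g (stdRep A v) + s • stdRep A v = stdRep A (adjMapConj g v + s • v)
      have h : adjMapConj g (stdRep A v) = stdRep A (adjMapConj g v) :=
        LinearMap.congr_fun (adjMapConj_comm hA) v
      rw [h, map_add, map_smul]
    change (f (π (stdRep A v)) : Fin 6 → ℝ) = stdRep A (f (π v))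
    rw [hπ, hfcomm A hA]
  obtain ⟨a, b, hab⟩ := exists_eq_smul_add_smul_conj hM
  obtain ⟨v, hv⟩ : ∃ v : eigSpace g s, v ≠ 0 := by
    have : Nontrivial (eigSpace g s) :=
      Module.nontrivial_of_finrank_pos (R := ℝ) (by rw [finrank_eigSpace hs]; norm_num)
    exact exists_ne 0
  have hMv : M v = (a + b * s) • (v : Fin 6 → ℝ) := by
    rw [hab, LinearMap.add_apply, LinearMap.smul_apply, LinearMap.smul_apply, mem_eigSpace.1 v.2,
      Module.End.one_apply, smul_smul, ← add_smul]
  have hM0 : M v = 0 := by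
    have h1 : M v ∈ eigSpace g s := by
      rw [hMv]
      exact Submodule.smul_mem _ _ v.2
    have h2 : M v ∈ eigSpace g (-s) := (f (π v)).2
    exact (Submodule.disjoint_def.1 (isCompl_eigSpace hs).disjoint) _ h1 h2
  have hπv : π v = 0 := hf ((Subtype.ext hM0).trans (map_zero f).symm)
  have hπv' : adjMapConj g v + s • (v : Fin 6 → ℝ) = 0 := congrArg Subtype.val hπv
  rw [mem_eigSpace.1 v.2, ← two_smul ℝ, smul_smul, smul_eq_zero] at hπv'
  exact hv (Subtype.ext (hπv'.resolve_left (by simpa using hs0)))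

theorem isCrystallographic_of_mem {H : Subgroup B6} (hH : H ∈ crystClass) :
    IsCrystallographic H := by
  obtain ⟨g, rfl⟩ := hH
  have hs : Real.sqrt 5 * Real.sqrt 5 = 5 := Real.mul_self_sqrt (by norm_num)
  have hs' : -Real.sqrt 5 * -Real.sqrt 5 = 5 := by rw [neg_mul_neg, hs]
  refine ⟨⟨(MonoidHom.ofInjective icosahedralRep_injective).trans
    (hatI.equivMapOfInjective _ (MulAut.conj g).injective)⟩,
    eigRep g (Real.sqrt 5), eigRep g (-Real.sqrt 5), isCompl_eigSpace hs, finrank_eigSpace hs,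
    finrank_eigSpace hs', isIrreducible_eigRep hs, isIrreducible_eigRep hs',
    isEmpty_equiv_eigRep hs⟩

/-! ### Crystallographic representations are in the class of the icosahedral group -/

theorem eq_zero_of_irreducible_of_line {H : Subgroup B6} {V : Subrepresentation (natRep H)}
    (hV : Module.finrank ℝ V.toSubmodule = 3) (hirr : V.toRepresentation.IsIrreducible)
    {a : Fin 6 → ℝ} (ha : a ∈ V.toSubmodule) (hinv : ∀ h : H, ∃ c : ℝ, natRep H h a = c • a) :
    a = 0 := by
  let U : Subrepresentation V.toRepresentation :=
    { toSubmodule := Submodule.span ℝ {⟨a, ha⟩}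
      apply_mem_toSubmodule := by
        intro h v hv
        obtain ⟨t, rfl⟩ := Submodule.mem_span_singleton.1 hv
        obtain ⟨c, hc⟩ := hinv h
        rw [map_smul]
        refine Submodule.smul_mem _ _ (Submodule.mem_span_singleton.2 ⟨c, ?_⟩)
        exact Subtype.ext hc.symm }
  rcases hirr.eq_bot_or_eq_top U with h | h
  · have h' : Submodule.span ℝ {(⟨a, ha⟩ : V.toSubmodule)} = ⊥ :=
      congrArg Subrepresentation.toSubmodule h
    exact congrArg Subtype.val (Submodule.span_singleton_eq_bot.1 h')
  · have h' : Submodule.span ℝ {(⟨a, ha⟩ : V.toSubmodule)} = ⊤ :=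
      congrArg Subrepresentation.toSubmodule h
    by_contra ha0
    have h1 := finrank_span_singleton (K := ℝ)
      (show (⟨a, ha⟩ : V.toSubmodule) ≠ 0 from fun h0 => ha0 (congrArg Subtype.val h0))
    rw [h', finrank_top, hV] at h1
    norm_num at h1

/-- A crystallographic representation leaves no line invariant. -/
theorem IsCrystallographic.eq_zero_of_line {H : Subgroup B6} (hH : IsCrystallographic H)
    {v : Fin 6 → ℝ} (hv : ∀ h : H, ∃ c : ℝ, natRep H h v = c • v) : v = 0 := by
  obtain ⟨-, V, W, hVW, hV, hW, hVi, hWi, -⟩ := hH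
  obtain ⟨a, ha, b, hb, rfl⟩ : ∃ a ∈ V.toSubmodule, ∃ b ∈ W.toSubmodule, a + b = v :=
    Submodule.mem_sup.1 (hVW.sup_eq_top ▸ Submodule.mem_top)
  have hab : ∀ h : H, ∃ c : ℝ, natRep H h a = c • a ∧ natRep H h b = c • b := by
    intro h
    obtain ⟨c, hc⟩ := hv h
    rw [map_add, smul_add] at hc
    -- The left side lies in `V` and the right side in `W`, so both vanish: each component spans an
    -- invariant line or is 0.
    have h1 : natRep H h a - c • a = c • b - natRep H h b := by
      rw [sub_eq_sub_iff_add_eq_add, hc, add_comm]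
    have h2 : natRep H h a - c • a ∈ V.toSubmodule :=
      Submodule.sub_mem _ (V.apply_mem_toSubmodule h ha) (Submodule.smul_mem _ _ ha)
    have h3 : natRep H h a - c • a ∈ W.toSubmodule := by
      rw [h1]
      exact Submodule.sub_mem _ (Submodule.smul_mem _ _ hb) (W.apply_mem_toSubmodule h hb)
    have h4 := Submodule.disjoint_def.1 hVW.disjoint _ h2 h3
    exact ⟨c, sub_eq_zero.1 h4, (sub_eq_zero.1 (h1.symm.trans h4)).symm⟩
  rw [eq_zero_of_irreducible_of_line hV hVi ha fun h => (hab h).imp fun _ h' => h'.1,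
    eq_zero_of_irreducible_of_line hW hWi hb fun h => (hab h).imp fun _ h' => h'.2, add_zero]

section Action

variable {Γ : Type*} [Group Γ]

/-- The stabilizer of a vertex under an action by permutations of the vertices. -/
def vertexStab (f : Γ →* Perm (Fin 12)) (k : Fin 12) : Subgroup Γ :=
  (MulAction.stabilizer (Perm (Fin 12)) k).comap f

theorem mem_vertexStab {f : Γ →* Perm (Fin 12)} {k : Fin 12} {h : Γ} :
    h ∈ vertexStab f k ↔ f h k = k := Iff.rfl

theorem ncard_range_mul_card_vertexStab (f : Γ →* Perm (Fin 12)) (k : Fin 12) :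
    (Set.range fun h => f h k).ncard * Nat.card (vertexStab f k) = Nat.card Γ := by
  let _ : MulAction Γ (Fin 12) := MulAction.compHom _ f
  rw [← Nat.card_coe_set_eq, ← Nat.card_prod]
  exact Nat.card_congr (MulAction.orbitProdStabilizerEquivGroup Γ k)

theorem vertexStab_apply (f : Γ →* Perm (Fin 12)) (k : Fin 12) (g : Γ) :
    vertexStab f (f g k) = conjBy g (vertexStab f k) := by
  ext h
  rw [mem_conjBy, mem_vertexStab, mem_vertexStab, map_mul, map_mul, map_inv, Perm.mul_apply,
    Perm.mul_apply, Perm.inv_eq_iff_eq, eq_comm]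

/-- The stabilizer of an axis under an action by signed permutations. -/
def axisStab (ψ : Γ →* signedPerms) (k : Fin 12) : Subgroup Γ where
  carrier := {h | SameAxis ((ψ h).1 k) k}
  one_mem' := by
    left
    rw [map_one]
    rfl
  mul_mem' {a b} ha hb := by
    rw [Set.mem_ofPred_eq, map_mul]
    exact ((sameAxis_apply (ψ a).2).2 hb).trans ha
  inv_mem' {a} ha := by
    rw [Set.mem_ofPred_eq, ← sameAxis_apply (ψ a).2, map_inv]
    have h : (ψ a).1 ((ψ a)⁻¹.1 k) = k := (ψ a).1.apply_symm_apply k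
    rw [h]
    exact ha.symm

theorem card_axisStab {ψ : Γ →* signedPerms} {k : Fin 12} (hk : ∃ h, (ψ h).1 k = k + 6) :
    Nat.card (axisStab ψ k) = 2 * Nat.card (vertexStab (signedPerms.subtype.comp ψ) k) := by
  have h := ncard_range_mul_card_vertexStab
    ((signedPerms.subtype.comp ψ).comp (axisStab ψ k).subtype) k
  have hrange : (Set.range fun h => ((signedPerms.subtype.comp ψ).comp (axisStab ψ k).subtype) h k) =
      {k, k + 6} := by
    ext l
    constructor
    · rintro ⟨h, rfl⟩
      exact h.2
    · rintro (rfl | rfl)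
      · exact ⟨1, by simp⟩
      · obtain ⟨h, hh⟩ := hk
        exact ⟨⟨h, Or.inr hh⟩, hh⟩
  have hle : vertexStab (signedPerms.subtype.comp ψ) k ≤ axisStab ψ k := fun h hh => Or.inl hh
  have hcard : Nat.card (vertexStab
      ((signedPerms.subtype.comp ψ).comp (axisStab ψ k).subtype) k) =
      Nat.card (vertexStab (signedPerms.subtype.comp ψ) k) :=
    Nat.card_congr (Subgroup.subgroupOfEquivOfLe hle).toEquiv
  rw [← h, hrange, hcard, Set.ncard_pair (add_six_ne k).symm]

/-- If an action by signed permutations leaves no line in `ℝ⁶` invariant, every vertex is mapped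
to its opposite. -/
theorem exists_apply_eq_add_six [Finite Γ] {ψ : Γ →* signedPerms}
    (hψ : ∀ v : Fin 6 → ℝ, (∀ h, ∃ c : ℝ, stdRep (signedRep (ψ h)) v = c • v) → v = 0)
    (k : Fin 12) : ∃ h, (ψ h).1 k = k + 6 := by
  by_contra! hk
  have : Fintype Γ := Fintype.ofFinite Γ
  -- The orbit sum is invariant, hence zero. If the opposite of `k` never occurred, the inner
  -- product of `w` with the vector of `k` would have only nonnegative terms, and the term of the
  -- identity is 1.
  let w : Fin 6 → ℝ := ∑ h, vertexVec ((ψ h).1 k)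
  have hw : w = 0 := by
    refine hψ w fun h => ⟨1, ?_⟩
    rw [one_smul, map_sum]
    change _ = ∑ h, vertexVec ((ψ h).1 k)
    rw [← Equiv.sum_comp (Equiv.mulLeft h) fun h => vertexVec ((ψ h).1 k)]
    refine Finset.sum_congr rfl fun x _ => ?_
    rw [stdRep_vertexVec, Equiv.coe_mulLeft, map_mul]
    rfl
  have hdot : ∀ k l : Fin 12, l ≠ k + 6 → 0 ≤ ∑ i, coord i k * coord i l := by decide +kernel
  have hdot1 : ∀ k : Fin 12, ∑ i, coord i k * coord i k = 1 := by decide +kernel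
  have hsum : ∑ h, ∑ i, coord i k * coord i ((ψ h).1 k) = 0 := by
    have h0 : ∑ i, (coord i k : ℝ) * w i = 0 := by simp [hw]
    simp only [w, Finset.sum_apply, vertexVec, Finset.mul_sum] at h0
    rw [Finset.sum_comm] at h0
    exact_mod_cast h0
  have h1 := (Finset.sum_eq_zero_iff_of_nonneg fun h _ => hdot _ _ (hk h)).1 hsum 1
    (Finset.mem_univ 1)
  rw [map_one] at h1
  exact one_ne_zero ((hdot1 k).symm.trans h1)

end Action

/-! ### Uniqueness of the action without invariant lines -/

variable {ψ : icosahedralGroup →* signedPerms}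

/-- Let n be the order of the stabilizer. An orbit has at most 12 points, so n ≥ 5; the axis
stabilizer has order 2n, so 2n divides 60 and n is 5, 6, 10, 15 or 30. There are no subgroups of
order 15 or 20, which excludes 15 and 10, and 2n = 60 would make the axis an invariant line. -/
theorem card_vertexStab_eq_five_or_six
    (hψ : ∀ v : Fin 6 → ℝ, (∀ h, ∃ c : ℝ, stdRep (signedRep (ψ h)) v = c • v) → v = 0)
    (k : Fin 12) : Nat.card (vertexStab (signedPerms.subtype.comp ψ) k) = 5 ∨
      Nat.card (vertexStab (signedPerms.subtype.comp ψ) k) = 6 := by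
  have horb := ncard_range_mul_card_vertexStab (signedPerms.subtype.comp ψ) k
  have hle : (Set.range fun h => (signedPerms.subtype.comp ψ) h k).ncard ≤ 12 :=
    (Set.ncard_le_card _).trans (by simp)
  have hA := card_axisStab (exists_apply_eq_add_six hψ k)
  have hdvd := Subgroup.card_subgroup_dvd_card (axisStab ψ k)
  rw [card_icosahedralGroup] at horb hdvd
  have h5 : 5 ∣ Nat.card (vertexStab (signedPerms.subtype.comp ψ) k) →
      Nat.card (vertexStab (signedPerms.subtype.comp ψ) k) < 25 →
      Nat.card (vertexStab (signedPerms.subtype.comp ψ) k) ≤ 10 := card_le_ten_of_five_dvd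
  have h5' : 5 ∣ Nat.card (axisStab ψ k) → Nat.card (axisStab ψ k) < 25 →
      Nat.card (axisStab ψ k) ≤ 10 := card_le_ten_of_five_dvd
  have h30 : Nat.card (axisStab ψ k) ≠ 60 := by
    intro h
    have htop : axisStab ψ k = ⊤ :=
      Subgroup.eq_top_of_card_eq _ (h.trans card_icosahedralGroup.symm)
    have h0 : vertexVec k = 0 := hψ _ fun h => by
      have hh : h ∈ axisStab ψ k := htop ▸ Subgroup.mem_top h
      rw [stdRep_vertexVec]
      rcases hh with hh | hh
      · exact ⟨1, by rw [hh, one_smul]⟩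
      · exact ⟨-1, by rw [hh, vertexVec_add_six, neg_one_smul]⟩
    have hne : ∀ k : Fin 12, ∃ i, coord i k ≠ 0 := by decide +kernel
    obtain ⟨i, hi⟩ := hne k
    have h1 : (coord i k : ℝ) = 0 := congrFun h0 i
    exact hi (by exact_mod_cast h1)
  rw [hA] at hdvd h5' h30
  have key : ∀ m n : ℕ, m * n = 60 → m ≤ 12 → 2 * n ∣ 60 → (5 ∣ n → n < 25 → n ≤ 10) →
      (5 ∣ 2 * n → 2 * n < 25 → 2 * n ≤ 10) → 2 * n ≠ 60 → n = 5 ∨ n = 6 := by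
    intro m n h1 h2 h3 h4 h5 h6
    have hn : n ∣ 60 := ⟨m, by rw [mul_comm, h1]⟩
    have hn' : n ∈ Nat.divisors 60 := Nat.mem_divisors.2 ⟨hn, by norm_num⟩
    have hdiv : ∀ n ∈ Nat.divisors 60, 2 * n ∣ 60 → 5 ≤ n → n = 5 ∨ n = 6 ∨ n = 10 ∨ n = 15 ∨
        n = 30 := by decide +kernel
    have := hdiv n hn' h3 (by nlinarith)
    omega
  exact key _ _ horb hle hdvd h5 h5' h30

/-- Every orbit has 60/5 or 60/6 points, so two disjoint orbits would need at least 20 of the 12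
vertices. -/
theorem range_eq_univ
    (hψ : ∀ v : Fin 6 → ℝ, (∀ h, ∃ c : ℝ, stdRep (signedRep (ψ h)) v = c • v) → v = 0)
    (k : Fin 12) : (Set.range fun h => (ψ h).1 k) = Set.univ := by
  have hge : ∀ k, 10 ≤ (Set.range fun h => (ψ h).1 k).ncard := by
    intro k
    have horb := ncard_range_mul_card_vertexStab (signedPerms.subtype.comp ψ) k
    rw [card_icosahedralGroup] at horb
    change (Set.range fun h => (ψ h).1 k).ncard * _ = 60 at horb
    rcases card_vertexStab_eq_five_or_six hψ k with h | h <;> rw [h] at horb <;> omega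
  by_contra hne
  obtain ⟨l, hl⟩ := (Set.ne_univ_iff_exists_notMem _).1 hne
  have hdisj : Disjoint (Set.range fun h => (ψ h).1 k) (Set.range fun h => (ψ h).1 l) := by
    rw [Set.disjoint_left]
    rintro _ ⟨g, rfl⟩ ⟨h, hh⟩
    refine hl ⟨h⁻¹ * g, ?_⟩
    change (ψ h).1 l = (ψ g).1 k at hh
    change (ψ (h⁻¹ * g)).1 k = l
    rw [map_mul, map_inv]
    change (ψ h).1⁻¹ ((ψ g).1 k) = l
    rw [Perm.inv_eq_iff_eq, hh]
  have h1 := Set.ncard_union_eq hdisj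
  have h2 : (Set.range (fun h => (ψ h).1 k) ∪ Set.range fun h => (ψ h).1 l).ncard ≤ 12 :=
    (Set.ncard_le_card _).trans (by simp)
  have := hge k
  have := hge l
  omega

theorem mem_sylowFive {p : icosahedralGroup} : p ∈ sylowFive ↔ p.1 0 = 0 := by
  have key : ∀ c ∈ icoCodes, (c ∈ [205163983024656, 178231316083536, 38833593366336,
      60770139351936, 135807773256336] ↔ digit c 0 = 0) := by decide +kernel
  have h := key _ (code_mem_icoCodes.2 p.2)
  have h0 : digit (code p.1) 0 = (p.1 0 : ℕ) := digit_code p.1 0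
  rw [sylowFive, mem_codeSubgroup, h, h0, Fin.ext_iff]
  rfl

/-- An action of the icosahedral group by signed permutations that leaves no line in `ℝ⁶` invariant
is equivalent to the action on the vertices. -/
theorem exists_equivariant
    (hψ : ∀ v : Fin 6 → ℝ, (∀ h, ∃ c : ℝ, stdRep (signedRep (ψ h)) v = c • v) → v = 0) :
    ∃ c : signedPerms, ∀ h, ψ h = c * ⟨h.1, icosahedralGroup_le h.2⟩ * c⁻¹ := by
  have hcard : Nat.card (vertexStab (signedPerms.subtype.comp ψ) 0) = 5 := by
    have horb := ncard_range_mul_card_vertexStab (signedPerms.subtype.comp ψ) 0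
    have hr : (Set.range fun h => (signedPerms.subtype.comp ψ) h 0) = Set.univ :=
      range_eq_univ hψ 0
    rw [card_icosahedralGroup, hr, Set.ncard_univ, Nat.card_eq_fintype_card, Fintype.card_fin]
      at horb
    omega
  -- Moving along the orbit conjugates the stabilizer, so some vertex `x` has under `ψ` the same
  -- stabilizer as the vertex 0 has under rotations.
  obtain ⟨g, hg⟩ := exists_conjBy_eq_of_card_eq (K := sylowFive) (hcard.trans card_sylowFive.symm)
    (by rw [hcard]; decide)
  rw [← vertexStab_apply] at hg
  generalize (signedPerms.subtype.comp ψ) g 0 = x at hg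
  have hx : ∀ h : icosahedralGroup, (ψ h).1 x = x ↔ h.1 0 = 0 := by
    intro h
    rw [← mem_sylowFive, ← hg]
    rfl
  have hx2 : ∀ g h : icosahedralGroup, (ψ g).1 x = (ψ h).1 x ↔ g.1 0 = h.1 0 := by
    intro g h
    have h1 := hx (h⁻¹ * g)
    rw [map_mul, map_inv] at h1
    change (ψ h).1⁻¹ ((ψ g).1 x) = x ↔ h.1⁻¹ (g.1 0) = 0 at h1
    rwa [Perm.inv_eq_iff_eq, Perm.inv_eq_iff_eq] at h1
  have hr : ∀ k : Fin 12, ∃ r : icosahedralGroup, r.1 0 = k := by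
    intro k
    obtain ⟨r, hr, h0, -⟩ := exists_rotation k (k + 1)
      ((by decide : ∀ k, ¬ SameAxis k (k + 1)) k)
    exact ⟨⟨r, hr⟩, h0⟩
  choose r hr using hr
  -- The equivariant map with 0 ↦ `x`; by `hx2` it does not depend on the choice of `r` and is
  -- injective.
  let f : Fin 12 → Fin 12 := fun k => (ψ (r k)).1 x
  have hf0 : ∀ h : icosahedralGroup, f (h.1 0) = (ψ h).1 x := fun h => (hx2 _ _).2 (hr _)
  have hf : ∀ (h : icosahedralGroup) (k : Fin 12), f (h.1 k) = (ψ h).1 (f k) := by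
    intro h k
    have h1 := hf0 (h * r k)
    rw [map_mul] at h1
    change f (h.1 ((r k).1 0)) = (ψ h).1 ((ψ (r k)).1 x) at h1
    rwa [hr] at h1
  have hinj : Function.Injective f := by
    intro k l hkl
    have := (hx2 _ _).1 hkl
    rwa [hr, hr] at this
  have hsurj := Finite.surjective_of_injective hinj
  have hf00 : f 0 = x := by simpa using hf0 1
  -- Equivariance alone does not give compatibility with opposition. But `ψ rot` fixes `x + 6`, so
  -- its preimage is fixed by the five-fold rotation, which fixes only 0 and 6.
  have h6 : f 6 = x + 6 := by
    obtain ⟨y, hy⟩ := hsurj (x + 6)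
    let rot : icosahedralGroup := ⟨g3 * g2, mul_mem (Subgroup.subset_closure (by simp))
      (Subgroup.subset_closure (by simp))⟩
    have hrot : (ψ rot).1 x = x := (hx rot).2 (by decide +kernel)
    have hry : rot.1 y = y := by
      refine hinj ?_
      rw [hf, hy, (ψ rot).2, hrot]
    have key : ∀ y, (g3 * g2) y = y → y = 0 ∨ y = 6 := by decide +kernel
    rcases key y hry with rfl | rfl
    · rw [hf00] at hy
      exact absurd hy.symm (add_six_ne x)
    · exact hy
  have hsigned : ∀ k, f (k + 6) = f k + 6 := by
    intro k
    obtain ⟨h, rfl⟩ : ∃ h : icosahedralGroup, h.1 0 = k := ⟨r k, hr k⟩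
    have e : h.1 0 + 6 = h.1 6 := (apply_add_six h 0).symm
    rw [e, hf, h6, (ψ h).2, hf0]
  refine ⟨⟨Equiv.ofBijective f ⟨hinj, hsurj⟩, hsigned⟩, fun h => ?_⟩
  rw [eq_mul_inv_iff_mul_eq]
  refine Subtype.ext (Equiv.ext fun k => ?_)
  exact (hf h k).symm

/-- Any abstract isomorphism onto `H` may be used: `exists_equivariant` makes no assumption on how
the rotations are identified with elements of `H`. -/
theorem mem_crystClass_of_isCrystallographic {H : Subgroup B6} (hH : IsCrystallographic H) :
    H ∈ crystClass := by
  obtain ⟨e⟩ := hH.1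
  let ψ : icosahedralGroup →* signedPerms :=
    signedEquiv.symm.toMonoidHom.comp (H.subtype.comp e.toMonoidHom)
  have hψe : ∀ h, signedRep (ψ h) = (e h).1 := fun h => signedEquiv.apply_symm_apply _
  obtain ⟨c, hc⟩ := exists_equivariant (ψ := ψ) fun v hv => hH.eq_zero_of_line fun h => by
    obtain ⟨t, ht⟩ := hv (e.symm h)
    rw [hψe, e.apply_symm_apply] at ht
    exact ⟨t, ht⟩
  refine ⟨signedRep c, ?_⟩
  have hle : H ≤ conjBy (signedRep c) hatI := by
    intro x hx
    have hx' : signedRep (ψ (e.symm ⟨x, hx⟩)) = x := by rw [hψe, e.apply_symm_apply]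
    rw [← hx', signedRep_mem_conjBy, hc]
    have h : ∀ a b : Perm (Fin 12), a⁻¹ * (a * b * a⁻¹) * a = b := fun a b => by group
    exact (h c.1 _).symm ▸ (e.symm ⟨x, hx⟩).2
  refine Subgroup.eq_of_le_of_card_ge hle ?_
  rw [card_of_mem_crystClass ⟨_, rfl⟩, ← Nat.card_congr e.toEquiv, card_icosahedralGroup]

end IcosahedralGraph

open IcosahedralGraph in
theorem mainTheorem4 :
    (∀ H : Subgroup B6, IsCrystallographic H ↔ H ∈ crystClass) ∧
    crystClass.encard = 192 ∧
    (∀ G : Subgroup icosahedralGroup, ∃ d : ℕ, (subgroupGraph G).IsRegularOfDegree d) ∧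
    (∀ (G : Subgroup icosahedralGroup) (d : ℕ),
      (Nonempty (G ≃* alternatingGroup (Fin 4)) ∧ d = 5) ∨
      (Nonempty (G ≃* DihedralGroup 5) ∧ d = 6) ∨
      (Nonempty (G ≃* DihedralGroup 3) ∧ d = 10) ∨
      (Nonempty (G ≃* Multiplicative (ZMod 5)) ∧ d = 0) ∨
      (Nonempty (G ≃* DihedralGroup 2) ∧ d = 30) ∨
      (Nonempty (G ≃* Multiplicative (ZMod 3)) ∧ d = 20) ∨
      (Nonempty (G ≃* Multiplicative (ZMod 2)) ∧ d = 60) ∨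
      (G = ⊥ ∧ d = 60) →
      (subgroupGraph G).IsRegularOfDegree d ∧
      ∀ H : Subgroup B6, IsCrystallographic H →
        {K ∈ crystClass | ∃ P ∈ conjClass (subgroupRep G), H ⊓ K = P}.encard = d) := by
  refine ⟨fun H => ⟨mem_crystClass_of_isCrystallographic, isCrystallographic_of_mem⟩,
    crystClass_encard, isRegular_subgroupGraph, fun G d hG => ?_⟩
  obtain ⟨hcard, rfl⟩ := card_and_count_of_type hG
  exact ⟨isRegularOfDegree_subgroupGraph hcard,
    fun H hH => encard_crystClass_inf hcard (mem_crystClass_of_isCrystallographic hH)⟩
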